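/- All graphs are finite, undirected and loopless, and may have multiple edges. A graph $H$ is a minor of a graph $G$ if a graph isomorphic to $H$ can be obtained from $G$ by removing vertices, removing edges and contracting edges (loops that arise are deleted, parallel edges are kept). For $r\in\mathbb{N}$ let $\theta_r$ be the graph with two vertices and $r$ parallel edges; the $\theta_r$-girth of $G$ is the minimum number of edges of a subgraph of $G$ that contains $\theta_r$ as a minor, and it is infinite if there is no such subgraph. For $\alpha,\beta\in\mathbb{N}$, a graph $G$ is $(\alpha,\beta)$-loosely connected if for all $A,B\subseteq V(G)$ with $A\cup B=V(G)$ and no edge of $G$ between $A\setminus B$ and $B\setminus A$, the inequality $|A\cap B|<\beta$ implies $\min(|A\setminus B|,|B\setminus A|)\le\alpha$. Theorem. There is a constant $c>0$ such that for all integers $r\ge 2$ and $\alpha\ge 1$ and every real number $z\ge 168\cdot\alpha\cdot r\cdot\log_2 r$ the following holds: if a connected graph $G$ with at least $z$ edges is $(\alpha,2r-1)$-loosely connected and has $\theta_r$-girth at least $z$, then $G$ contains as a minor a complete graph on $k$ vertices for some integer $$k\ \ge\ \frac{2^{\,c\cdot\frac{z}{r\alpha}}}{\sqrt{rz}}.$$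 -/

import Mathlib

open scoped Graph

namespace Graph

universe u v u' v'

/-- Two multigraphs are isomorphic: there are bijections between their vertex sets and between
their edge sets that respect the ends of the edges. -/
def IsIsomorphicTo {ν : Type u} {ε : Type v} {ν' : Type u'} {ε' : Type v'}
    (G : Graph ν ε) (H : Graph ν' ε') : Prop :=
  ∃ (f : V(G) ≃ V(H)) (g : E(G) ≃ E(H)), ∀ (e : E(G)) (x y : V(G)),
    G.IsLink e x y ↔ H.IsLink (g e) (f x) (f y)

open Classical in
/-- The contraction, in a loopless multigraph, of an edge with ends `x` and `y`: the vertex `y` is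
identified with `x`, and all the edges between `x` and `y`, which would become loops, disappear.
All other edges are kept, also when they become parallel. -/
noncomputable def contract {ν : Type u} {ε : Type v} (G : Graph ν ε) (x y : ν) : Graph ν ε :=
  (G.deleteEdges {e | G.IsLink e x y}).map (fun w => if w = y then x else w)

/-- One operation: the removal of a vertex, the removal of an edge, or the contraction of
an edge. -/
inductive MinorStep {ν : Type u} {ε : Type v} : Graph ν ε → Graph ν ε → Prop
  | deleteVert (G : Graph ν ε) (x : ν) (hx : x ∈ V(G)) : MinorStep G (G.deleteVerts {x})
  | deleteEdge (G : Graph ν ε) (e : ε) (he : e ∈ E(G)) : MinorStep G (G.deleteEdges {e})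
  | contractEdge (G : Graph ν ε) (e : ε) (x y : ν) (he : G.IsLink e x y) (hxy : x ≠ y) :
      MinorStep G (G.contract x y)

/-- `H` is a minor of `G`: up to isomorphism, `H` is obtained from `G` by finitely many removals of
vertices, removals of edges and contractions of edges. -/
def IsMinorOf {ν : Type u} {ε : Type v} {ν' : Type u'} {ε' : Type v'}
    (H : Graph ν' ε') (G : Graph ν ε) : Prop :=
  ∃ G' : Graph ν ε, Relation.ReflTransGen MinorStep G G' ∧ G'.IsIsomorphicTo H

/-- An `H`-model in `G` is a subgraph of `G` that contains `H` as a minor. -/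
def IsModelIn {ν : Type u} {ε : Type v} {ν' : Type u'} {ε' : Type v'}
    (M : Graph ν ε) (H : Graph ν' ε') (G : Graph ν ε) : Prop :=
  M ≤ G ∧ H.IsMinorOf M

/-- The `H`-girth of `G`: the minimum number of edges of an `H`-model in `G`, which is `⊤` if there
is no such model. -/
noncomputable def minorGirth {ν : Type u} {ε : Type v} {ν' : Type u'} {ε' : Type v'}
    (H : Graph ν' ε') (G : Graph ν ε) : ℕ∞ :=
  ⨅ (M : Graph ν ε) (_ : M.IsModelIn H G), E(M).encard

/-- The graph `θ_r` with two vertices and `r` parallel edges. -/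
def theta (r : ℕ) : Graph (Fin 2) (Fin r) :=
  Graph.banana 0 1 Set.univ

/-- The complete graph of order `k`. -/
def clique (k : ℕ) : Graph (Fin k) (Sym2 (Fin k)) :=
  Graph.ofSimpleGraph (⊤ : SimpleGraph (Fin k))

/-- `(α, β)`-loose connectivity of a finite graph: no separation `(A, B)` of order less than `β`
has more than `α` vertices on both of its sides. -/
def LooselyConnected {ν : Type u} {ε : Type v} (G : Graph ν ε) (α β : ℕ) : Prop :=
  ∀ A B : Set ν, A ∪ B = V(G) → (∀ x ∈ A \ B, ∀ y ∈ B \ A, ¬ G.Adj x y) →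
    (A ∩ B).ncard < β → min (A \ B).ncard (B \ A).ncard ≤ α

end Graph

/-!
If two disjoint connected sets of vertices are joined by `r` edges, then spanning trees of the two
sets together with these edges form a subgraph that contains `θ_r`. Hence, when the `θ_r`-girth is
large, disjoint connected sets with few vertices, or of small radius, are joined by fewer than `r`
edges. Choose a maximal set of vertices at pairwise distance more than `2ℓ` and partition the graph
into breadth-first trees rooted there; two such trees are joined by fewer than `r` edges. Loose
connectivity bounds from below the number of edges leaving a subtree with more than `α` vertices,
and this forces the number of large subtrees to double every `α + 1` levels. So exponentially many
edges leave every tree, and contracting the trees gives a minor of exponentially large minimum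
degree. As in Mader's argument, a smallest dense minor of this minor has an edge whose ends have
many common neighbours; it contains a small dense graph, in which a complete minor is built greedily
from branch sets of bounded size.
-/

namespace LooseConnectivity

open Finset Graph

section Connected

variable {V W : Type*} {H : SimpleGraph V}

/-- `S` induces a connected subgraph of `H`; in particular, `S` is nonempty. -/
def IsConnectedSet (H : SimpleGraph V) (S : Finset V) : Prop :=
  (H.induce (S : Set V)).Connected

variable {S T U : Finset V} {x y : V}

lemma IsConnectedSet.nonempty (hS : IsConnectedSet H S) : S.Nonempty :=
  let ⟨x⟩ := SimpleGraph.Connected.nonempty hS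
  ⟨x, x.2⟩

lemma IsConnectedSet.forall_of_closed (hS : IsConnectedSet H S) {P : V → Prop} (hx : x ∈ S)
    (hPx : P x) (hP : ∀ a ∈ S, P a → ∀ b ∈ S, H.Adj a b → P b) : ∀ y ∈ S, P y := by
  intro y hy
  obtain ⟨p⟩ := hS.preconnected ⟨x, hx⟩ ⟨y, hy⟩
  suffices ∀ (a b : (S : Set V)), (H.induce (S : Set V)).Walk a b → P a → P b from this _ _ p hPx
  intro a b q
  induction q with
  | nil => exact id
  | cons hab _ ih => exact fun ha => ih (hP _ (Subtype.prop _) ha _ (Subtype.prop _) hab)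

lemma isConnectedSet_of_forall_closed (hx : x ∈ S)
    (h : ∀ P : V → Prop, P x → (∀ a ∈ S, P a → ∀ b ∈ S, H.Adj a b → P b) → ∀ y ∈ S, P y) :
    IsConnectedSet H S := by
  refine (SimpleGraph.connected_iff_exists_forall_reachable _).2 ⟨⟨x, hx⟩, fun ⟨y, hy⟩ => ?_⟩
  obtain ⟨_, hxy⟩ := h (fun y => ∃ hy : y ∈ S, (H.induce (S : Set V)).Reachable ⟨x, hx⟩ ⟨y, hy⟩)
    ⟨hx, .rfl⟩ (fun a _ ⟨_, hxa⟩ b hb hab =>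
      ⟨hb, hxa.trans (SimpleGraph.Adj.reachable (G := H.induce (S : Set V)) hab)⟩) y hy
  exact hxy

lemma isConnectedSet_singleton (x : V) : IsConnectedSet H {x} :=
  isConnectedSet_of_forall_closed (mem_singleton_self x) fun P hx _ y hy => by
    rwa [mem_singleton.1 hy]

lemma isConnectedSet_univ [Fintype V] (hH : H.Connected) : IsConnectedSet H univ := by
  rw [IsConnectedSet, coe_univ]
  exact (SimpleGraph.induceUnivIso H).connected_iff.2 hH

lemma IsConnectedSet.exists_adj (hS : IsConnectedSet H S) (hx : x ∈ S) (hxT : x ∈ T) (hy : y ∈ S)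
    (hyT : y ∉ T) : ∃ a ∈ S, a ∈ T ∧ ∃ b ∈ S, b ∉ T ∧ H.Adj a b := by
  by_contra! h
  exact hyT (hS.forall_of_closed hx hxT (fun a ha haT b hb hab => by
    by_contra hbT
    exact h a ha haT b hb hbT hab) y hy)

lemma IsConnectedSet.image [DecidableEq W] {K : SimpleGraph W} (hS : IsConnectedSet H S)
    (f : V → W) (hf : ∀ a ∈ S, ∀ b ∈ S, H.Adj a b → f a = f b ∨ K.Adj (f a) (f b)) :
    IsConnectedSet K (S.image f) := by
  obtain ⟨x, hx⟩ := hS.nonempty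
  refine isConnectedSet_of_forall_closed (mem_image_of_mem f hx) fun P hPx hP => ?_
  refine forall_mem_image.2 (hS.forall_of_closed (P := P ∘ f) hx hPx fun a ha hPa b hb hab => ?_)
  obtain h | h := hf a ha b hb hab
  · exact (congrArg P h).mp hPa
  · exact hP _ (mem_image_of_mem f ha) hPa _ (mem_image_of_mem f hb) h

lemma IsConnectedSet.mono {K : SimpleGraph V} (hS : IsConnectedSet H S)
    (h : ∀ a ∈ S, ∀ b ∈ S, H.Adj a b → K.Adj a b) : IsConnectedSet K S := by
  classical
  simpa using hS.image id fun a ha b hb hab => .inr (h a ha b hb hab)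

variable [DecidableEq V]

lemma IsConnectedSet.union_of_adj (hS : IsConnectedSet H S) (hT : IsConnectedSet H T)
    (hx : x ∈ S) (hy : y ∈ T) (hxy : H.Adj x y) : IsConnectedSet H (S ∪ T) := by
  refine isConnectedSet_of_forall_closed (mem_union_left T hx) fun P hPx hP => ?_
  have hPS : ∀ a ∈ S, P a := hS.forall_of_closed hx hPx fun a ha hPa b hb hab =>
    hP a (mem_union_left T ha) hPa b (mem_union_left T hb) hab
  have hPT : ∀ a ∈ T, P a :=
    hT.forall_of_closed hy (hP x (mem_union_left T hx) hPx y (mem_union_right S hy) hxy)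
      fun a ha hPa b hb hab =>
        hP a (mem_union_right S ha) hPa b (mem_union_right S hb) hab
  exact fun a ha => (mem_union.1 ha).elim (hPS a) (hPT a)

lemma IsConnectedSet.insert_of_adj (hS : IsConnectedSet H S) (hx : x ∈ S) (hxy : H.Adj x y) :
    IsConnectedSet H (insert y S) := by
  rw [insert_eq, union_comm]
  exact hS.union_of_adj (isConnectedSet_singleton y) hx (mem_singleton_self y) hxy

lemma isConnectedSet_biUnion_of_mem {ι : Type*} {I : Finset ι} {D : ι → Finset V}
    (hI : I.Nonempty) (hD : ∀ i ∈ I, IsConnectedSet H (D i)) (hx : ∀ i ∈ I, x ∈ D i) :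
    IsConnectedSet H (I.biUnion D) := by
  obtain ⟨i₀, hi₀⟩ := hI
  refine isConnectedSet_of_forall_closed (mem_biUnion.2 ⟨i₀, hi₀, hx i₀ hi₀⟩) ?_
  intro P hPx hP y hy
  obtain ⟨i, hi, hy⟩ := mem_biUnion.1 hy
  exact (hD i hi).forall_of_closed (hx i hi) hPx (fun a ha hPa b hb hab =>
    hP a (mem_biUnion.2 ⟨i, hi, ha⟩) hPa b (mem_biUnion.2 ⟨i, hi, hb⟩) hab) y hy

lemma IsConnectedSet.biUnion {K : SimpleGraph W} {I : Finset W} (hI : IsConnectedSet K I)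
    {B : W → Finset V} (hB : ∀ w ∈ I, IsConnectedSet H (B w))
    (hK : ∀ w ∈ I, ∀ w' ∈ I, K.Adj w w' → ∃ x ∈ B w, ∃ y ∈ B w', H.Adj x y) :
    IsConnectedSet H (I.biUnion B) := by
  obtain ⟨w₀, hw₀⟩ := hI.nonempty
  obtain ⟨x, hx⟩ := (hB w₀ hw₀).nonempty
  refine isConnectedSet_of_forall_closed (mem_biUnion.2 ⟨w₀, hw₀, hx⟩) fun P hPx hP => ?_
  have hPB : ∀ w ∈ I, ∀ a ∈ B w, P a → ∀ b ∈ B w, P b := fun w hw a ha hPa =>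
    (hB w hw).forall_of_closed ha hPa fun a ha hPa b hb hab =>
      hP a (mem_biUnion.2 ⟨w, hw, ha⟩) hPa b (mem_biUnion.2 ⟨w, hw, hb⟩) hab
  have hPI : ∀ w ∈ I, ∀ a ∈ B w, P a := by
    refine hI.forall_of_closed hw₀ (hPB w₀ hw₀ x hx hPx) fun w hw hPw w' hw' hww' => ?_
    obtain ⟨a, ha, b, hb, hab⟩ := hK w hw w' hw' hww'
    exact hPB w' hw' b hb
      (hP a (mem_biUnion.2 ⟨w, hw, ha⟩) (hPw a ha) b (mem_biUnion.2 ⟨w', hw', hb⟩) hab)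
  intro y hy
  obtain ⟨w, hw, hy⟩ := mem_biUnion.1 hy
  exact hPI w hw y hy

lemma IsConnectedSet.exists_erase (hS : IsConnectedSet H S) (hcard : 1 < #S) :
    ∃ x ∈ S, IsConnectedSet H (S.erase x) := by
  have : Nontrivial (S : Set V) := (one_lt_card_iff_nontrivial.1 hcard).coe_sort
  obtain ⟨x, hx⟩ :=
    SimpleGraph.Connected.exists_connected_induce_compl_singleton_of_finite_nontrivial hS
  refine ⟨x, x.2, hx.map (H := H.induce (S.erase x : Set V)) ⟨fun y => ⟨y.1, ?_⟩, id⟩ ?_⟩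
  · exact mem_coe.2 (mem_erase.2 ⟨fun h => y.2 (Subtype.ext h), y.1.2⟩)
  · exact fun ⟨y, hy⟩ => ⟨⟨⟨y, mem_of_mem_erase hy⟩,
      fun h => ne_of_mem_erase hy (congrArg Subtype.val h)⟩, rfl⟩

@[elab_as_elim]
lemma IsConnectedSet.induction {motive : ∀ S : Finset V, IsConnectedSet H S → Prop}
    (singleton : ∀ x, motive {x} (isConnectedSet_singleton x))
    (insert : ∀ S x y (hS : IsConnectedSet H S) (hx : x ∈ S) (_ : y ∉ S) (hxy : H.Adj x y),
      motive S hS → motive (insert y S) (hS.insert_of_adj hx hxy)) (hS : IsConnectedSet H S) :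
    motive S hS := by
  induction h : #S generalizing S with
  | zero => exact absurd (card_eq_zero.1 h) hS.nonempty.ne_empty
  | succ n ih =>
    obtain rfl | hn := n.eq_zero_or_pos
    · obtain ⟨x, rfl⟩ := card_eq_one.1 h
      exact singleton x
    obtain ⟨y, hy, hconn⟩ := hS.exists_erase (by lia)
    obtain ⟨z, hz⟩ := hconn.nonempty
    obtain ⟨a, -, ha, b, hb, hbS, hab⟩ := hS.exists_adj (mem_of_mem_erase hz) hz hy
      (notMem_erase y S)
    obtain rfl : b = y := by simpa [hb] using hbS
    have hins := insert _ a b hconn ha hbS hab (ih hconn (by rw [card_erase_of_mem hy, h]; rfl))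
    simpa only [insert_erase hy] using hins

/-- `C` is the vertex set of a connected component of the subgraph of `H` induced on `U`. -/
structure IsComponentIn (H : SimpleGraph V) (U C : Finset V) : Prop where
  subset : C ⊆ U
  isConnectedSet : IsConnectedSet H C
  mem_of_adj : ∀ a ∈ C, ∀ b ∈ U, H.Adj a b → b ∈ C

omit [DecidableEq V] in
lemma exists_isComponentIn (hx : x ∈ U) : ∃ C, IsComponentIn H U C ∧ x ∈ C := by
  classical
  let 𝓒 := {D ∈ U.powerset | x ∈ D ∧ IsConnectedSet H D}
  have mem_𝓒 {D : Finset V} : D ∈ 𝓒 ↔ D ⊆ U ∧ x ∈ D ∧ IsConnectedSet H D := by simp [𝓒]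
  have hx𝓒 : {x} ∈ 𝓒 :=
    mem_𝓒.2 ⟨by simpa using hx, mem_singleton_self x, isConnectedSet_singleton x⟩
  have hC : IsConnectedSet H (𝓒.biUnion id) :=
    isConnectedSet_biUnion_of_mem ⟨{x}, hx𝓒⟩ (fun D hD => (mem_𝓒.1 hD).2.2)
      fun D hD => (mem_𝓒.1 hD).2.1
  have hCU : 𝓒.biUnion id ⊆ U := biUnion_subset.2 fun D hD => (mem_𝓒.1 hD).1
  have hxC : x ∈ 𝓒.biUnion id := mem_biUnion.2 ⟨{x}, hx𝓒, mem_singleton_self x⟩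
  refine ⟨_, ⟨hCU, hC, fun a ha b hb hab => ?_⟩, hxC⟩
  exact mem_biUnion.2 ⟨insert b (𝓒.biUnion id), mem_𝓒.2 ⟨insert_subset hb hCU,
    mem_insert_of_mem hxC, hC.insert_of_adj ha hab⟩, mem_insert_self _ _⟩

lemma IsComponentIn.isConnectedSet_sdiff {C : Finset V} (hC : IsComponentIn H (U.erase x) C)
    (hU : IsConnectedSet H U) (hx : x ∈ U) : IsConnectedSet H (U \ C) := by
  have hxC : x ∉ C := fun h => notMem_erase x U (hC.subset h)
  refine isConnectedSet_of_forall_closed (mem_sdiff.2 ⟨hx, hxC⟩) fun P hPx hP y hy => ?_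
  refine (hU.forall_of_closed (P := fun y => P y ∨ y ∈ C) hx (.inl hPx) ?_ y
    (mem_sdiff.1 hy).1).resolve_right (mem_sdiff.1 hy).2
  intro a ha hPa b hb hab
  by_cases hbC : b ∈ C
  · exact .inr hbC
  by_cases haC : a ∈ C
  · obtain rfl | hbx := eq_or_ne b x
    · exact .inl hPx
    · exact .inr (hC.mem_of_adj a haC b (mem_erase.2 ⟨hbx, hb⟩) hab)
  · exact .inl (hP a (mem_sdiff.2 ⟨ha, haC⟩) (hPa.resolve_right haC) b
      (mem_sdiff.2 ⟨hb, hbC⟩) hab)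

lemma card_le_of_subset_erase_of_minimal [Fintype V] {D : Finset V} {m : ℕ}
    (hU : IsConnectedSet H U) (hUc : IsConnectedSet H Uᶜ)
    (hmin : ∀ C, IsConnectedSet H C → IsConnectedSet H Cᶜ → m < #C → #U ≤ #C) (hx : x ∈ U)
    (hy : y ∈ Uᶜ) (hyx : H.Adj y x) (hD : IsConnectedSet H D) (hDU : D ⊆ U.erase x) : #D ≤ m := by
  obtain ⟨z, hz⟩ := hD.nonempty
  obtain ⟨C, hC, hzC⟩ := exists_isComponentIn (H := H) (hDU hz)
  have hDC : D ⊆ C := hD.forall_of_closed hz hzC fun a _ haC b hb hab =>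
    hC.mem_of_adj a haC b (hDU hb) hab
  have hxC : x ∉ C := fun h => notMem_erase x U (hC.subset h)
  have hCU : C ⊆ U := hC.subset.trans (erase_subset x U)
  have hCc : IsConnectedSet H Cᶜ := by
    have hsplit : Cᶜ = Uᶜ ∪ U \ C := by
      ext a
      have := @hCU a
      simp only [mem_compl, mem_union, mem_sdiff]
      tauto
    rw [hsplit]
    exact hUc.union_of_adj (hC.isConnectedSet_sdiff hU hx) hy (mem_sdiff.2 ⟨hx, hxC⟩) hyx
  by_contra! hlt
  have hle := hmin C hC.isConnectedSet hCc (hlt.trans_le (card_le_card hDC))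
  exact hle.not_gt (card_lt_card ⟨hCU, fun h => hxC (h hx)⟩)

lemma card_le_two_mul_of_minimal [Fintype V] {x' y' : V} {m : ℕ}
    (hU : IsConnectedSet H U) (hUc : IsConnectedSet H Uᶜ)
    (hmin : ∀ C, IsConnectedSet H C → IsConnectedSet H Cᶜ → m < #C → #U ≤ #C) (hx : x ∈ U)
    (hy : y ∈ Uᶜ) (hyx : H.Adj y x) (hx' : x' ∈ U) (hy' : y' ∈ Uᶜ) (hyx' : H.Adj y' x')
    (hne : x ≠ x') : #U ≤ 2 * m := by
  obtain ⟨C, hC, hx'C⟩ := exists_isComponentIn (H := H) (mem_erase.2 ⟨hne.symm, hx'⟩)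
  have hCm := card_le_of_subset_erase_of_minimal hU hUc hmin hx hy hyx hC.isConnectedSet hC.subset
  have hUC := card_le_of_subset_erase_of_minimal hU hUc hmin hx' hy' hyx'
    (hC.isConnectedSet_sdiff hU hx)
    (subset_erase.2 ⟨sdiff_subset, fun h => (mem_sdiff.1 h).2 hx'C⟩)
  have := card_sdiff_add_card_eq_card (hC.subset.trans (erase_subset x U))
  lia

lemma exists_isConnectedSet_compl_minimal [Fintype V] (hH : H.Connected) {m : ℕ}
    (hm : m + 1 < Fintype.card V) :
    ∃ U, IsConnectedSet H U ∧ IsConnectedSet H Uᶜ ∧ m < #U ∧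
      ∀ C, IsConnectedSet H C → IsConnectedSet H Cᶜ → m < #C → #U ≤ #C := by
  obtain ⟨w, -, hw⟩ := (isConnectedSet_univ hH).exists_erase (by rw [card_univ]; lia)
  have hwm : m < #(univ.erase w) := by
    rw [card_erase_of_mem (mem_univ w), card_univ]
    lia
  obtain ⟨U, ⟨hU, hUc, hUm⟩, hmin⟩ := exists_minimalFor_of_wellFoundedLT
    (fun U => IsConnectedSet H U ∧ IsConnectedSet H Uᶜ ∧ m < #U) card
    ⟨univ.erase w, hw, by simpa using isConnectedSet_singleton w, hwm⟩
  refine ⟨U, hU, hUc, hUm, fun C hC hCc hCm => ?_⟩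
  by_contra! hlt
  exact hlt.not_ge (hmin ⟨hC, hCc, hCm⟩ hlt.le)

lemma exists_isComponentIn_card_sdiff_le {m : ℕ}
    (h : ∀ X ⊆ U, (∀ a ∈ X, ∀ b ∈ U, H.Adj a b → b ∈ X) → #X ≤ m ∨ #(U \ X) ≤ m)
    (hcard : 3 * m < #U) : ∃ C, IsComponentIn H U C ∧ #(U \ C) ≤ m := by
  classical
  by_contra! hlarge
  obtain ⟨X, hX, hmax⟩ := exists_max_image
    {X ∈ U.powerset | (∀ a ∈ X, ∀ b ∈ U, H.Adj a b → b ∈ X) ∧ #X ≤ m} card ⟨∅, by simp⟩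
  simp only [mem_filter, mem_powerset, and_imp] at hX hmax
  obtain ⟨hXU, hXclosed, hXm⟩ := hX
  have hcardX := card_sdiff_add_card_eq_card hXU
  obtain ⟨x, hx⟩ : (U \ X).Nonempty := card_pos.1 (by lia)
  obtain ⟨C, hC, hxC⟩ := exists_isComponentIn (H := H) (mem_sdiff.1 hx).1
  have hCm : #C ≤ m := (h C hC.subset hC.mem_of_adj).resolve_right (hlarge C hC).not_ge
  have hclosed : ∀ a ∈ X ∪ C, ∀ b ∈ U, H.Adj a b → b ∈ X ∪ C := fun a ha b hb hab =>
    mem_union.2 ((mem_union.1 ha).imp (hXclosed a · b hb hab) (hC.mem_of_adj a · b hb hab))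
  have hsub : X ∪ C ⊆ U := union_subset hXU hC.subset
  have hlt : #X < #(X ∪ C) := card_lt_card ⟨subset_union_left, fun hsub =>
    (mem_sdiff.1 hx).2 (hsub (mem_union_right X hxC))⟩
  have hm := hmax (X ∪ C) hsub hclosed
  have := card_union_le X C
  have := card_sdiff_add_card_eq_card hsub
  have := h _ hsub hclosed
  lia

end Connected

section Minor

variable {ν ε ν' ε' : Type*} {G : Graph ν ε} {K : Graph ν' ε'} {x y : ν}

/-- The simple graph of the adjacency of `G` on the whole ambient type. In contrast to
`Graph.toSimpleGraph`, its vertex type stays the same when `G` is replaced by a minor. -/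
def adjGraph (G : Graph ν ε) : SimpleGraph ν := SimpleGraph.fromRel G.Adj

lemma adjGraph_adj : (adjGraph G).Adj x y ↔ x ≠ y ∧ G.Adj x y := by
  simp [adjGraph, Graph.adj_comm y x]

lemma size_lt_of_minorStep {G' : Graph ν ε} (h : MinorStep G G') (hV : V(G).Finite)
    (hE : E(G).Finite) :
    V(G').Finite ∧ E(G').Finite ∧ V(G').ncard + E(G').ncard < V(G).ncard + E(G).ncard := by
  suffices V(G') ⊆ V(G) ∧ E(G') ⊆ E(G) ∧ (V(G') ≠ V(G) ∨ E(G') ≠ E(G)) by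
    obtain ⟨hVsub, hEsub, hne⟩ := this
    refine ⟨hV.subset hVsub, hE.subset hEsub, ?_⟩
    obtain hne | hne := hne
    · exact add_lt_add_of_lt_of_le (Set.ncard_lt_ncard (hVsub.ssubset_of_ne hne) hV)
        (Set.ncard_le_ncard hEsub hE)
    · exact add_lt_add_of_le_of_lt (Set.ncard_le_ncard hVsub hV)
        (Set.ncard_lt_ncard (hEsub.ssubset_of_ne hne) hE)
  cases h with
  | deleteVert x hx =>
    exact ⟨deleteVerts_le.vertexSet_mono, deleteVerts_le.edgeSet_mono, .inl fun h =>
      (vertexSet_deleteVerts G {x} ▸ h.symm.subset hx : x ∈ V(G) \ {x}).2 rfl⟩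
  | deleteEdge e he =>
    exact ⟨deleteEdges_le.vertexSet_mono, deleteEdges_le.edgeSet_mono, .inr fun h =>
      (edgeSet_deleteEdges G {e} ▸ h.symm.subset he : e ∈ E(G) \ {e}).2 rfl⟩
  | contractEdge e x y he hxy =>
    have hmem : ∀ a ∈ V(G.contract x y), a ∈ V(G) ∧ a ≠ y := by
      rintro _ ⟨a, ha, rfl⟩
      obtain rfl | hay := eq_or_ne a y
      · simpa using ⟨he.left_mem, hxy⟩
      · simpa [hay] using ha
    have hEsub : E(G.contract x y) ⊆ E(G) := by
      simp [Graph.contract]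
    exact ⟨fun a ha => (hmem a ha).1, hEsub, .inl fun h => (hmem y (h ▸ he.right_mem)).2 rfl⟩

/-- Disjoint connected branch sets `B v` for the vertices `v` of `K`, together with distinct edges
`η e` of `G` that join the branch sets of the ends of the edges `e` of `K`. -/
structure IsMinorModel (G : Graph ν ε) (K : Graph ν' ε') (B : ν' → Finset ν)
    (η : E(K) → ε) : Prop where
  subset : ∀ v ∈ V(K), ∀ a ∈ B v, a ∈ V(G)
  isConnectedSet : ∀ v ∈ V(K), IsConnectedSet (adjGraph G) (B v)
  eq_of_mem : ∀ v ∈ V(K), ∀ w ∈ V(K), ∀ a ∈ B v, a ∈ B w → v = w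
  injective : Function.Injective η
  exists_isLink : ∀ (e : E(K)) v w, K.IsLink e v w → ∃ a ∈ B v, ∃ b ∈ B w, G.IsLink (η e) a b

namespace IsMinorModel

variable {B : ν' → Finset ν} {η : E(K) → ε}

lemma deleteVerts (h : IsMinorModel G K B η) (hx : ∀ v ∈ V(K), x ∉ B v) :
    IsMinorModel (G.deleteVerts {x}) K B η where
  subset v hv a ha := by
    simpa using ⟨h.subset v hv a ha, fun hax : a = x => hx v hv (hax ▸ ha)⟩
  isConnectedSet v hv := (h.isConnectedSet v hv).mono fun a ha b hb hab => by
    obtain ⟨hne, e, he⟩ := adjGraph_adj.1 hab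
    refine adjGraph_adj.2 ⟨hne, e, ?_⟩
    rw [deleteVerts_isLink]
    exact ⟨he, fun hax => hx v hv (hax ▸ ha), fun hbx => hx v hv (hbx ▸ hb)⟩
  eq_of_mem := h.eq_of_mem
  injective := h.injective
  exists_isLink e v w hvw := by
    obtain ⟨a, ha, b, hb, hab⟩ := h.exists_isLink e v w hvw
    refine ⟨a, ha, b, hb, ?_⟩
    rw [deleteVerts_isLink]
    exact ⟨hab, fun hax => hx v hvw.left_mem (hax ▸ ha), fun hbx => hx w hvw.right_mem (hbx ▸ hb)⟩

lemma contract [DecidableEq ν] (h : IsMinorModel G K B η) (hK : K.Loopless) {v₀ : ν'}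
    (hv₀ : v₀ ∈ V(K)) (hx : x ∈ B v₀) (hy : y ∈ B v₀) :
    IsMinorModel (G.contract x y) K (fun v => (B v).image fun a => if a = y then x else a) η where
  subset v hv := forall_mem_image.2 fun a ha => by
    simp only [Graph.contract, vertexSet_map, vertexSet_deleteEdges]
    exact ⟨a, h.subset v hv a ha, by dsimp only; congr⟩
  isConnectedSet v hv := (h.isConnectedSet v hv).image _ fun a _ b _ hab => by
    refine or_iff_not_imp_left.2 fun hne => adjGraph_adj.2 ⟨hne, ?_⟩
    obtain ⟨-, e, he⟩ := adjGraph_adj.1 hab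
    refine ⟨e, a, b, ?_, by dsimp only; congr, by dsimp only; congr⟩
    rw [deleteEdges_isLink]
    refine ⟨he, fun hexy => hne ?_⟩
    obtain ⟨rfl, rfl⟩ | ⟨rfl, rfl⟩ := he.eq_and_eq_or_eq_and_eq hexy <;> simp
  eq_of_mem v hv w hw := forall_mem_image.2 fun a ha haw => by
    obtain ⟨b, hb, hab⟩ := mem_image.1 haw
    have := h.eq_of_mem v hv w hw
    have := h.eq_of_mem v hv v₀ hv₀
    have := h.eq_of_mem w hw v₀ hv₀
    grind
  injective := h.injective
  exists_isLink e v w hvw := by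
    obtain ⟨a, ha, b, hb, hab⟩ := h.exists_isLink e v w hvw
    refine ⟨_, mem_image_of_mem _ ha, _, mem_image_of_mem _ hb, a, b, ?_,
      by dsimp only; congr, by dsimp only; congr⟩
    rw [deleteEdges_isLink]
    refine ⟨hab, fun hexy : G.IsLink (η e) x y => hvw.ne ?_⟩
    obtain ⟨rfl, rfl⟩ | ⟨rfl, rfl⟩ := hab.eq_and_eq_or_eq_and_eq hexy
    · rw [h.eq_of_mem v hvw.left_mem v₀ hv₀ _ ha hx, h.eq_of_mem w hvw.right_mem v₀ hv₀ _ hb hy]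
    · rw [h.eq_of_mem v hvw.left_mem v₀ hv₀ _ ha hy, h.eq_of_mem w hvw.right_mem v₀ hv₀ _ hb hx]

lemma deleteEdges (h : IsMinorModel G K B η) (hB : ∀ v ∈ V(K), #(B v) = 1) {f : ε}
    (hf : f ∉ Set.range η) : IsMinorModel (G.deleteEdges {f}) K B η where
  subset v hv a ha := by simpa using h.subset v hv a ha
  isConnectedSet v hv := by
    obtain ⟨a, ha⟩ := card_eq_one.1 (hB v hv)
    exact ha ▸ isConnectedSet_singleton a
  eq_of_mem := h.eq_of_mem
  injective := h.injective
  exists_isLink e v w hvw := by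
    obtain ⟨a, ha, b, hb, hab⟩ := h.exists_isLink e v w hvw
    refine ⟨a, ha, b, hb, ?_⟩
    rw [deleteEdges_isLink]
    exact ⟨hab, fun hef => hf ⟨e, hef⟩⟩

lemma isIsomorphicTo (h : IsMinorModel G K B η) (hB : ∀ v ∈ V(K), #(B v) = 1)
    (hV : ∀ a ∈ V(G), ∃ v ∈ V(K), a ∈ B v) (hE : ∀ f ∈ E(G), f ∈ Set.range η) :
    G.IsIsomorphicTo K := by
  have hex : ∀ v : V(K), ∃ a : V(G), B v = {a.1} := fun v => by
    obtain ⟨a, ha⟩ := card_eq_one.1 (hB v v.2)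
    exact ⟨⟨a, h.subset v v.2 a (by simp [ha])⟩, ha⟩
  choose b hb using hex
  have hbinj : Function.Injective b := fun v w hvw => Subtype.ext <|
    h.eq_of_mem v v.2 w w.2 (b v) (by simp [hb]) (by simp [hb, hvw])
  have hbsurj : Function.Surjective b := fun a => by
    obtain ⟨v, hv, ha⟩ := hV a a.2
    rw [hb ⟨v, hv⟩, mem_singleton] at ha
    exact ⟨⟨v, hv⟩, Subtype.ext ha.symm⟩
  have hlink : ∀ (e : E(K)) v w, K.IsLink e v w → ∃ (hv : v ∈ V(K)) (hw : w ∈ V(K)),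
      G.IsLink (η e) (b ⟨v, hv⟩) (b ⟨w, hw⟩) := fun e v w hvw => by
    obtain ⟨a, ha, c, hc, hac⟩ := h.exists_isLink e v w hvw
    rw [hb ⟨v, hvw.left_mem⟩, mem_singleton] at ha
    rw [hb ⟨w, hvw.right_mem⟩, mem_singleton] at hc
    exact ⟨hvw.left_mem, hvw.right_mem, ha ▸ hc ▸ hac⟩
  have hηmem : ∀ e, η e ∈ E(G) := fun e => by
    obtain ⟨v, w, hvw⟩ := exists_isLink_of_mem_edgeSet e.2
    exact (hlink e v w hvw).elim fun _ ⟨_, h⟩ => h.edge_mem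
  let f := Equiv.ofBijective b ⟨hbinj, hbsurj⟩
  let g : E(K) ≃ E(G) := Equiv.ofBijective (fun e => ⟨η e, hηmem e⟩)
    ⟨fun e e' hee' => h.injective (congrArg Subtype.val hee'), fun e =>
      (hE e e.2).imp fun _ => Subtype.ext⟩
  refine ⟨f.symm, g.symm, fun e x y => ?_⟩
  obtain ⟨e, rfl⟩ := g.surjective e
  obtain ⟨v, rfl⟩ := f.surjective x
  obtain ⟨w, rfl⟩ := f.surjective y
  simp only [Equiv.symm_apply_apply]
  refine ⟨fun hvw => ?_, fun hvw => (hlink e v w hvw).elim fun _ ⟨_, h⟩ => h⟩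
  obtain ⟨v', w', hvw'⟩ := exists_isLink_of_mem_edgeSet e.2
  obtain ⟨hv', hw', hlk⟩ := hlink e v' w' hvw'
  obtain ⟨h₁, h₂⟩ | ⟨h₁, h₂⟩ := hlk.eq_and_eq_or_eq_and_eq hvw
  · rwa [← hbinj (Subtype.ext h₁), ← hbinj (Subtype.ext h₂)]
  · rw [← hbinj (Subtype.ext h₁), ← hbinj (Subtype.ext h₂)]
    exact hvw'.symm

lemma exists_adj_of_one_lt_card (h : IsMinorModel G K B η) {v : ν'} (hv : v ∈ V(K))
    (hcard : 1 < #(B v)) : ∃ x ∈ B v, ∃ y ∈ B v, x ≠ y ∧ G.Adj x y := by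
  obtain ⟨p, hp, q, hq, hpq⟩ := one_lt_card.1 hcard
  obtain ⟨x, hx, -, y, hy, -, hxy⟩ := (h.isConnectedSet v hv).exists_adj hp
    (mem_singleton_self p) hq (by simpa using hpq.symm)
  exact ⟨x, hx, y, hy, adjGraph_adj.1 hxy⟩

lemma exists_minorStep (h : IsMinorModel G K B η) (hK : K.Loopless) :
    G.IsIsomorphicTo K ∨ ∃ G' B', MinorStep G G' ∧ IsMinorModel G' K B' η := by
  classical
  by_cases hcover : ∀ a ∈ V(G), ∃ v ∈ V(K), a ∈ B v
  swap
  · push Not at hcover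
    obtain ⟨a, ha, haB⟩ := hcover
    exact .inr ⟨_, B, .deleteVert G a ha, h.deleteVerts haB⟩
  by_cases hB : ∀ v ∈ V(K), #(B v) = 1
  swap
  · push Not at hB
    obtain ⟨v, hv, hcard⟩ := hB
    have := (h.isConnectedSet v hv).nonempty.card_pos
    obtain ⟨x, hx, y, hy, hne, e, he⟩ := h.exists_adj_of_one_lt_card hv (by lia)
    exact .inr ⟨_, _, .contractEdge G e x y he hne, h.contract hK hv hx hy⟩
  by_cases hf : ∀ f ∈ E(G), f ∈ Set.range η
  · exact .inl (h.isIsomorphicTo hB hcover hf)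
  · push Not at hf
    obtain ⟨f, hf, hfη⟩ := hf
    exact .inr ⟨_, B, .deleteEdge G f hf, h.deleteEdges hB hfη⟩

theorem isMinorOf (h : IsMinorModel G K B η) (hK : K.Loopless) (hV : V(G).Finite)
    (hE : E(G).Finite) : K.IsMinorOf G := by
  induction hn : V(G).ncard + E(G).ncard using Nat.strong_induction_on generalizing G B with
  | _ n ih =>
  obtain hiso | ⟨G', B', hstep, hB'⟩ := h.exists_minorStep hK
  · exact ⟨G, .refl, hiso⟩
  · obtain ⟨hV', hE', hlt⟩ := size_lt_of_minorStep hstep hV hE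
    obtain ⟨G'', hG'', hiso⟩ := ih _ (hn ▸ hlt) hB' hV' hE' rfl
    exact ⟨G'', hG''.head hstep, hiso⟩

end IsMinorModel

lemma theta_isMinorOf (hV : V(G).Finite) (hE : E(G).Finite) {r : ℕ} {S U : Finset ν}
    (hS : IsConnectedSet (adjGraph G) S) (hU : IsConnectedSet (adjGraph G) U)
    (hSG : ∀ a ∈ S, a ∈ V(G)) (hUG : ∀ a ∈ U, a ∈ V(G)) (hSU : Disjoint S U) {η : Fin r → ε}
    (hη : Function.Injective η) (hlink : ∀ i, ∃ a ∈ S, ∃ b ∈ U, G.IsLink (η i) a b) :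
    (theta r).IsMinorOf G := by
  have isLink_iff : ∀ (e : Fin r) (v w : Fin 2),
      (theta r).IsLink e v w ↔ (v = 0 ∧ w = 1) ∨ (v = 1 ∧ w = 0) := by simp [theta]
  refine IsMinorModel.isMinorOf (B := ![S, U]) (η := fun e => η e) ⟨?_, ?_, ?_, ?_, ?_⟩
    ⟨fun e v h => ?_⟩ hV hE
  · simpa [Fin.forall_fin_two, theta] using ⟨hSG, hUG⟩
  · simpa [Fin.forall_fin_two, theta] using ⟨hS, hU⟩
  · simpa [Fin.forall_fin_two, theta] using ⟨disjoint_left.1 hSU, disjoint_right.1 hSU⟩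
  · exact hη.comp Subtype.val_injective
  · intro e v w hvw
    obtain ⟨a, ha, b, hb, hab⟩ := hlink e
    obtain ⟨rfl, rfl⟩ | ⟨rfl, rfl⟩ := (isLink_iff e v w).1 hvw
    · exact ⟨a, ha, b, hb, hab⟩
    · exact ⟨b, hb, a, ha, hab.symm⟩
  · obtain ⟨rfl, h⟩ | ⟨rfl, h⟩ := (isLink_iff e v v).1 h <;> exact absurd h (by decide)

lemma clique_isMinorOf (hV : V(G).Finite) (hE : E(G).Finite) {k : ℕ} {B : Fin k → Finset ν}
    (hBG : ∀ i, ∀ a ∈ B i, a ∈ V(G)) (hB : ∀ i, IsConnectedSet (adjGraph G) (B i))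
    (hdisj : ∀ i j, i ≠ j → Disjoint (B i) (B j))
    (hadj : ∀ i j, i ≠ j → ∃ a ∈ B i, ∃ b ∈ B j, G.Adj a b) : (clique k).IsMinorOf G := by
  have isLink_iff : ∀ (e : Sym2 (Fin k)) (i j : Fin k),
      (clique k).IsLink e i j ↔ e = s(i, j) ∧ i ≠ j := by
    refine fun e i j => ⟨?_, ?_⟩
    all_goals
      rintro ⟨rfl, h⟩
      exact ⟨rfl, by simpa using h⟩
  have hex : ∀ e : E(clique k), ∃ f, ∀ i j, (clique k).IsLink e i j →
      ∃ a ∈ B i, ∃ b ∈ B j, G.IsLink f a b := fun e => by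
    obtain ⟨i, j, h⟩ := exists_isLink_of_mem_edgeSet e.2
    obtain ⟨a, ha, b, hb, f, hf⟩ := hadj i j ((isLink_iff _ _ _).1 h).2
    refine ⟨f, fun i' j' h' => ?_⟩
    obtain ⟨rfl, rfl⟩ | ⟨rfl, rfl⟩ := h.eq_and_eq_or_eq_and_eq h'
    · exact ⟨a, ha, b, hb, hf⟩
    · exact ⟨b, hb, a, ha, hf.symm⟩
  choose η hη using hex
  have eq_of_mem : ∀ i j a, a ∈ B i → a ∈ B j → i = j := fun i j a hi hj => by
    by_contra hij
    exact disjoint_left.1 (hdisj i j hij) hi hj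
  have hinj : Function.Injective η := fun e e' heq => Subtype.ext <| by
    obtain ⟨i, j, h⟩ := exists_isLink_of_mem_edgeSet e.2
    obtain ⟨i', j', h'⟩ := exists_isLink_of_mem_edgeSet e'.2
    obtain ⟨a, ha, b, hb, hf⟩ := hη e i j h
    obtain ⟨a', ha', b', hb', hf'⟩ := hη e' i' j' h'
    rw [((isLink_iff _ _ _).1 h).1, ((isLink_iff _ _ _).1 h').1]
    rw [heq] at hf
    obtain ⟨rfl, rfl⟩ | ⟨rfl, rfl⟩ := hf.eq_and_eq_or_eq_and_eq hf'
    · rw [eq_of_mem _ _ _ ha ha', eq_of_mem _ _ _ hb hb']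
    · rw [eq_of_mem _ _ _ ha hb', eq_of_mem _ _ _ hb ha', Sym2.eq_swap]
  exact IsMinorModel.isMinorOf ⟨fun i _ => hBG i, fun i _ => hB i,
    fun i _ j _ a => eq_of_mem i j a, hinj, hη⟩ ⟨fun e i h => ((isLink_iff _ _ _).1 h).2 rfl⟩ hV hE

end Minor

section EdgeCount

variable {ν ε : Type*} {G : Graph ν ε} {S T U : Finset V(G)} {r : ℕ}

/-- The number of edges between `S` and `T`, where the edges with both ends in `S ∩ T` are counted
twice. -/
noncomputable def edgeCount (G : Graph ν ε) (S T : Finset V(G)) : ℕ :=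
  ∑ x ∈ S, ∑ y ∈ T, {e : E(G) | G.IsLink e x y}.ncard

lemma edgeCount_comm (S T : Finset V(G)) : edgeCount G S T = edgeCount G T S := by
  rw [edgeCount, sum_comm]
  simp only [edgeCount, isLink_comm]

lemma edgeCount_biUnion_left [DecidableEq V(G)] {ι : Type*} {I : Finset ι} {B : ι → Finset V(G)}
    (hB : (I : Set ι).PairwiseDisjoint B) (T : Finset V(G)) :
    edgeCount G (I.biUnion B) T = ∑ i ∈ I, edgeCount G (B i) T :=
  sum_biUnion hB

lemma edgeCount_union_left [DecidableEq V(G)] (h : Disjoint S T) (U : Finset V(G)) :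
    edgeCount G (S ∪ T) U = edgeCount G S U + edgeCount G T U :=
  sum_union h

lemma edgeCount_union_right [DecidableEq V(G)] (U : Finset V(G)) (h : Disjoint S T) :
    edgeCount G U (S ∪ T) = edgeCount G U S + edgeCount G U T := by
  simp only [edgeCount_comm U, edgeCount_union_left h]

lemma edgeCount_mono {S' T' : Finset V(G)} (hS : S ⊆ S') (hT : T ⊆ T') :
    edgeCount G S T ≤ edgeCount G S' T' :=
  (sum_le_sum fun _ _ => sum_le_sum_of_subset hT).trans (sum_le_sum_of_subset hS)

lemma edgeCount_pos_of_adj [Finite E(G)] {x y : V(G)} (hx : x ∈ S) (hy : y ∈ T)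
    (hxy : G.toSimpleGraph.Adj x y) : 0 < edgeCount G S T := by
  obtain ⟨-, e, he⟩ := hxy
  refine sum_pos' (fun _ _ => Nat.zero_le _)
    ⟨x, hx, sum_pos' (fun _ _ => Nat.zero_le _) ⟨y, hy, ?_⟩⟩
  exact (Set.ncard_pos (Set.toFinite _)).2 ⟨⟨e, he.edge_mem⟩, he⟩

lemma exists_adj_of_edgeCount_pos [G.Loopless] (h : 0 < edgeCount G S T) :
    ∃ x ∈ S, ∃ y ∈ T, G.toSimpleGraph.Adj x y := by
  obtain ⟨x, hx, hpos⟩ := exists_ne_zero_of_sum_ne_zero h.ne'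
  obtain ⟨y, hy, hpos⟩ := exists_ne_zero_of_sum_ne_zero hpos
  obtain ⟨e, he⟩ := Set.nonempty_of_ncard_ne_zero hpos
  exact ⟨x, hx, y, hy, (toSimpleGraph_adj_iff x y).2 ⟨e, he⟩⟩

lemma edgeCount_eq_zero_of_forall_not_adj [G.Loopless]
    (h : ∀ x ∈ S, ∀ y ∈ T, ¬ G.toSimpleGraph.Adj x y) : edgeCount G S T = 0 := by
  by_contra hpos
  obtain ⟨x, hx, y, hy, hxy⟩ := exists_adj_of_edgeCount_pos (Nat.pos_of_ne_zero hpos)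
  exact h x hx y hy hxy

open Classical in
lemma edgeCount_eq_sum_card [Fintype E(G)] (S T : Finset V(G)) :
    edgeCount G S T = ∑ e : E(G), #{p ∈ S ×ˢ T | G.IsLink e p.1 p.2} := by
  rw [edgeCount, ← sum_product']
  simp only [Set.ncard_eq_toFinset_card', Set.toFinset_ofPred, card_filter]
  exact sum_comm

lemma edgeCount_univ [G.Loopless] [Fintype V(G)] [Finite E(G)] :
    edgeCount G univ univ = 2 * E(G).ncard := by
  classical
  have := Fintype.ofFinite E(G)
  rw [edgeCount_eq_sum_card, ← Nat.card_coe_set_eq, Nat.card_eq_fintype_card, mul_comm,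
    ← smul_eq_mul, Fintype.card, ← sum_const]
  refine sum_congr rfl fun e _ => ?_
  obtain ⟨x, y, hxy⟩ := exists_isLink_of_mem_edgeSet e.2
  refine card_eq_two.2 ⟨(⟨x, hxy.left_mem⟩, ⟨y, hxy.right_mem⟩),
    (⟨y, hxy.right_mem⟩, ⟨x, hxy.left_mem⟩), by simp [hxy.ne], ?_⟩
  ext ⟨a, b⟩
  have : G.IsLink e a b ↔ (x = a.1 ∧ y = b.1) ∨ (x = b.1 ∧ y = a.1) := hxy.isLink_iff
  simp only [mem_filter, mem_product, mem_univ, and_self, true_and, this, mem_insert,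
    mem_singleton, Prod.ext_iff, Subtype.ext_iff]
  tauto

lemma exists_injective_isLink_of_le_edgeCount [Finite E(G)] (hST : Disjoint S T)
    (h : r ≤ edgeCount G S T) : ∃ η : Fin r → E(G), Function.Injective η ∧
      ∀ i, ∃ x ∈ S, ∃ y ∈ T, G.IsLink (η i) x y := by
  classical
  have := Fintype.ofFinite E(G)
  let F : Finset E(G) := {e | ∃ x ∈ S, ∃ y ∈ T, G.IsLink e x y}
  have hF : edgeCount G S T ≤ #F := by
    rw [edgeCount_eq_sum_card, card_filter]
    refine sum_le_sum fun e _ => ?_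
    split_ifs with he
    · refine card_le_one.2 fun p hp q hq => ?_
      simp only [mem_filter, mem_product] at hp hq
      obtain ⟨h₁, h₂⟩ | ⟨h₁, -⟩ := hp.2.eq_and_eq_or_eq_and_eq hq.2
      · exact Prod.ext (Subtype.ext h₁) (Subtype.ext h₂)
      · exact absurd (Subtype.ext h₁ ▸ hq.1.2) (disjoint_left.1 hST hp.1.1)
    · simp only [Nat.le_zero, card_eq_zero, filter_eq_empty_iff, mem_product]
      exact fun p hp hlink => he ⟨p.1, hp.1, p.2, hp.2, hlink⟩
  obtain ⟨F', hF', rfl⟩ := exists_subset_card_eq (h.trans hF)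
  exact ⟨fun i => F'.equivFin.symm i, Subtype.val_injective.comp (Equiv.injective _),
    fun i => (mem_filter.1 (hF' (F'.equivFin.symm i).2)).2⟩

lemma exists_subset_card_le_of_le_edgeCount (h : r ≤ edgeCount G S T) :
    ∃ X ⊆ S, #X ≤ r ∧ r ≤ edgeCount G X T := by
  let f : V(G) → ℕ := fun x => ∑ y ∈ T, {e : E(G) | G.IsLink e x y}.ncard
  obtain hle | hlt := le_or_gt #{x ∈ S | f x ≠ 0} r
  · exact ⟨_, filter_subset _ _, hle, h.trans (sum_filter_ne_zero S).ge⟩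
  · obtain ⟨X, hX, rfl⟩ := exists_subset_card_eq hlt.le
    refine ⟨X, hX.trans (filter_subset _ _), le_rfl, ?_⟩
    calc #X = #X • 1 := by simp
      _ ≤ edgeCount G X T := X.card_nsmul_le_sum f 1 fun x hx =>
          Nat.one_le_iff_ne_zero.2 (mem_filter.1 (hX hx)).2

end EdgeCount

section ThetaSparse

variable {ν ε : Type*} {G : Graph ν ε} {S : Finset V(G)} {r N : ℕ}

/-- There are fewer than `r` edges between any two disjoint connected sets with at most `m` vertices
in total. Such sets are the candidates for the branch sets of a small model of `θ_r`. -/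
def ThetaSparse (G : Graph ν ε) (r m : ℕ) : Prop :=
  ∀ S T : Finset V(G), IsConnectedSet G.toSimpleGraph S → IsConnectedSet G.toSimpleGraph T →
    Disjoint S T → #S + #T ≤ m → edgeCount G S T < r

lemma IsConnectedSet.exists_spanning_edges (hS : IsConnectedSet G.toSimpleGraph S) :
    ∃ F : Finset ε, #F + 1 ≤ #S ∧ ∀ F' : Set ε, ↑F ⊆ F' →
      IsConnectedSet (adjGraph (G.restrict F')) (S.map (.subtype _)) := by
  classical
  induction hS using IsConnectedSet.induction with
  | singleton x =>
    exact ⟨∅, by simp, fun _ _ => by simpa using isConnectedSet_singleton _⟩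
  | insert S x y _ hx hy hxy ih =>
    obtain ⟨F, hF, hconn⟩ := ih
    obtain ⟨-, e, he⟩ := hxy
    have hcard := card_insert_le e F
    refine ⟨insert e F, by rw [card_insert_of_notMem hy]; lia, fun F' hF' => ?_⟩
    rw [coe_insert, Set.insert_subset_iff] at hF'
    rw [map_insert]
    refine (hconn F' hF'.2).insert_of_adj (mem_map_of_mem _ hx) (adjGraph_adj.2 ⟨?_, e, ?_⟩)
    · exact fun h => hy (Subtype.ext h ▸ hx)
    · simpa using ⟨hF'.1, he⟩

lemma thetaSparse_of_le_minorGirth [Finite V(G)] [Finite E(G)]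
    (h : (N : ℕ∞) ≤ minorGirth (theta r) G) : ThetaSparse G r (N + 1 - r) := by
  classical
  intro S T hS hT hST hcard
  by_contra! hr
  obtain ⟨η, hη, hlink⟩ := exists_injective_isLink_of_le_edgeCount hST hr
  obtain ⟨F, hF, hSF⟩ := hS.exists_spanning_edges
  obtain ⟨F', hF', hTF'⟩ := hT.exists_spanning_edges
  let D : Finset ε := F ∪ F' ∪ univ.image fun i => (η i : ε)
  have hD : E(G.restrict D).encard < N := by
    have hsub : E(G.restrict D) ⊆ D := by simp
    have hDcard : #D ≤ #F + #F' + r := by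
      refine (card_union_le _ _).trans (add_le_add (card_union_le _ _) ?_)
      simpa using card_image_le (s := univ) (f := fun i => (η i : ε))
    refine (Set.encard_le_encard hsub).trans_lt ?_
    rw [Set.encard_coe_eq_coe_finsetCard]
    exact_mod_cast (by lia : #D < N)
  refine (h.trans (iInf₂_le (G.restrict D) ⟨restrict_le, ?_⟩)).not_gt hD
  refine theta_isMinorOf (η := fun i => (η i : ε)) (by simpa using Set.toFinite V(G))
    ((Set.toFinite E(G)).subset restrict_le.edgeSet_mono) (hSF D (by grind)) (hTF' D (by grind))
    (by simp +contextual) (by simp +contextual) (disjoint_map _ |>.2 hST)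
    (Subtype.val_injective.comp hη) fun i => ?_
  obtain ⟨x, hx, y, hy, hxy⟩ := hlink i
  refine ⟨x, mem_map_of_mem _ hx, y, mem_map_of_mem _ hy, ?_⟩
  simpa [D] using hxy

end ThetaSparse

section EdgeCount

variable {ν ε : Type*} {G : Graph ν ε}

open Classical in
lemma card_filter_exists_adj_le_edgeCount [Finite E(G)] (S T : Finset V(G)) :
    #{x ∈ S | ∃ y ∈ T, G.toSimpleGraph.Adj x y} ≤ edgeCount G S T := by
  rw [card_filter]
  refine sum_le_sum fun x _ => ?_
  split_ifs with h
  · obtain ⟨y, hy, hxy⟩ := h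
    simpa only [edgeCount, sum_singleton] using
      Nat.one_le_iff_ne_zero.2 (edgeCount_pos_of_adj (mem_singleton_self x) hy hxy).ne'
  · exact Nat.zero_le _

lemma edgeCount_insert_insert [DecidableEq V(G)] [G.Loopless] {w : V(G)} {W : Finset V(G)}
    (hw : w ∉ W) :
    edgeCount G (insert w W) (insert w W) = edgeCount G W W + 2 * edgeCount G {w} W := by
  have hloop : edgeCount G {w} {w} = 0 := edgeCount_eq_zero_of_forall_not_adj (by simp)
  have hdisj := disjoint_singleton_left.2 hw
  rw [insert_eq, edgeCount_union_left hdisj, edgeCount_union_right _ hdisj,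
    edgeCount_union_right _ hdisj, hloop, edgeCount_comm W {w}]
  lia

lemma exists_edgeCount_self_le_four_mul [DecidableEq V(G)] [G.Loopless] (W : Finset V(G)) :
    ∃ S T, Disjoint S T ∧ S ∪ T = W ∧ edgeCount G W W ≤ 4 * edgeCount G S T := by
  induction W using Finset.induction_on with
  | empty => exact ⟨∅, ∅, by simp, by simp, by simp [edgeCount]⟩
  | insert w W hw ih =>
    obtain ⟨S, T, hST, rfl, hcut⟩ := ih
    wlog hle : edgeCount G {w} S ≤ edgeCount G {w} T generalizing S T
    · rw [union_comm] at hw hcut ⊢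
      exact this T S hST.symm hw (by rwa [edgeCount_comm T]) (by lia)
    rw [mem_union, not_or] at hw
    refine ⟨insert w S, T, disjoint_insert_left.2 ⟨hw.2, hST⟩, insert_union _ _ _, ?_⟩
    rw [edgeCount_insert_insert (by simpa using hw), edgeCount_union_right {w} hST, insert_eq,
      edgeCount_union_left (disjoint_singleton_left.2 hw.1)]
    lia

end EdgeCount

section LooselyConnected

variable {ν ε : Type*} {G : Graph ν ε} [Fintype V(G)] {S T U X Y : Finset V(G)}
  {α β r m : ℕ}

lemma card_le_or_of_looselyConnected (hG : G.LooselyConnected α β) (hXY : Disjoint X Y)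
    (hadj : ∀ x ∈ X, ∀ y ∈ Y, ¬ G.toSimpleGraph.Adj x y)
    (hcard : Fintype.card V(G) < #X + #Y + β) : #X ≤ α ∨ #Y ≤ α := by
  classical
  have hinj : Function.Injective (Subtype.val : V(G) → ν) := Subtype.val_injective
  have hdiff : ∀ {Z W : Finset V(G)}, Disjoint Z W →
      (Subtype.val '' (Wᶜ : Set V(G))) \ (Subtype.val '' (Zᶜ : Set V(G))) =
        Subtype.val '' (Z : Set V(G)) := by
    intro Z W hZW
    rw [← Set.image_sdiff hinj]
    congr 1
    ext x
    simpa using fun hx hxW => disjoint_left.1 hZW hx hxW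
  have h := hG (Subtype.val '' (Yᶜ : Set V(G))) (Subtype.val '' (Xᶜ : Set V(G))) ?_ ?_ ?_
  · rw [hdiff hXY, hdiff hXY.symm, Set.ncard_image_of_injective _ hinj,
      Set.ncard_image_of_injective _ hinj, Set.ncard_coe_finset, Set.ncard_coe_finset] at h
    exact min_le_iff.1 h
  · rw [← Set.image_union, ← Set.compl_inter, ← coe_inter, inter_comm,
      disjoint_iff_inter_eq_empty.1 hXY]
    simp
  · rw [hdiff hXY, hdiff hXY.symm]
    rintro _ ⟨x, hx, rfl⟩ _ ⟨y, hy, rfl⟩ hxy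
    exact hadj x hx y hy ⟨fun h => disjoint_left.1 hXY hx (h ▸ hy), hxy⟩
  · rw [← Set.image_inter hinj, ← Set.compl_union, Set.ncard_image_of_injective _ hinj,
      ← coe_union, ← coe_compl, Set.ncard_coe_finset, card_compl, card_union_of_disjoint hXY.symm]
    have := card_le_univ (X ∪ Y)
    rw [card_union_of_disjoint hXY] at this
    lia

variable [DecidableEq V(G)]

/-- The edge version of `(α, β)`-loose connectivity: there are at least `β` edges between `S` and
its complement whenever both have more than `α` vertices. -/
def EdgeLooselyConnected (G : Graph ν ε) [Fintype V(G)] [DecidableEq V(G)] (α β : ℕ) : Prop :=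
  ∀ S : Finset V(G), α < #S → α < #Sᶜ → β ≤ edgeCount G S Sᶜ

lemma edgeLooselyConnected_of_looselyConnected [Finite E(G)] (hG : G.LooselyConnected α β)
    (hcard : β + 2 * α < Fintype.card V(G)) : EdgeLooselyConnected G α β := by
  classical
  intro S hS hSc
  by_contra! hlt
  let I : Finset V(G) := {x ∈ S | ∀ y ∈ Sᶜ, ¬ G.toSimpleGraph.Adj x y}
  have hSI : #(S \ I) ≤ edgeCount G S Sᶜ := by
    refine (card_le_card fun x hx => ?_).trans (card_filter_exists_adj_le_edgeCount S Sᶜ)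
    obtain ⟨hxS, hxI⟩ := mem_sdiff.1 hx
    exact mem_filter.2 ⟨hxS, by simpa [I, hxS] using hxI⟩
  have hI : #I ≤ α := by
    have := card_sdiff_add_card_eq_card (filter_subset _ S : I ⊆ S)
    have := card_add_card_compl S
    exact (card_le_or_of_looselyConnected hG (disjoint_compl_right.mono_left (filter_subset _ S))
      (fun x hx => (mem_filter.1 hx).2) (by lia)).resolve_right hSc.not_ge
  obtain ⟨X, hIX, hXS, hX⟩ := exists_subsuperset_card_eq (filter_subset _ S) (hI.trans (by lia)) hS
  let N : Finset V(G) := {y ∈ Sᶜ | ∃ x ∈ X, G.toSimpleGraph.Adj y x}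
  have hSX : #(S \ X) ≤ edgeCount G (S \ X) Sᶜ := by
    refine (card_le_card fun x hx => ?_).trans (card_filter_exists_adj_le_edgeCount (S \ X) Sᶜ)
    have hxI : x ∉ I := fun h => (mem_sdiff.1 hx).2 (hIX h)
    simpa [(mem_sdiff.1 hx).1, (mem_sdiff.1 hx).2, I] using hxI
  have hN : #N ≤ edgeCount G X Sᶜ :=
    (card_filter_exists_adj_le_edgeCount _ _).trans_eq (edgeCount_comm _ _)
  have hsplit : edgeCount G S Sᶜ = edgeCount G (S \ X) Sᶜ + edgeCount G X Sᶜ := by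
    rw [← edgeCount_union_left sdiff_disjoint, sdiff_union_of_subset hXS]
  have := card_sdiff_add_card_eq_card hXS
  have := card_sdiff_add_card_eq_card (filter_subset _ Sᶜ : N ⊆ Sᶜ)
  have := card_add_card_compl S
  have := card_le_or_of_looselyConnected hG (Y := Sᶜ \ N)
    (disjoint_compl_right.mono hXS sdiff_subset) (fun x hx y hy hxy => (mem_sdiff.1 hy).2
      (mem_filter.2 ⟨(mem_sdiff.1 hy).1, x, hx, hxy.symm⟩)) (by lia)
  lia

lemma exists_isComponentIn_of_looselyConnected (hG : G.LooselyConnected α β) {a : ℕ} (ha : α ≤ a)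
    (hcard : Fintype.card V(G) < #U + β ∨ Fintype.card V(G) < 2 * a + 2 + β) (hU : 3 * a < #U) :
    ∃ C, IsComponentIn G.toSimpleGraph U C ∧ #(U \ C) ≤ a := by
  refine exists_isComponentIn_card_sdiff_le (fun X hXU hX => ?_) hU
  by_contra! hlarge
  have := card_sdiff_add_card_eq_card hXU
  have := card_le_or_of_looselyConnected hG (disjoint_sdiff : Disjoint X (U \ X))
    (fun x hx y hy hxy => (mem_sdiff.1 hy).2 (hX x hx y (mem_sdiff.1 hy).1 hxy)) (by lia)
  lia

lemma exists_isConnectedSet_compl_of_looselyConnected (hG : G.LooselyConnected α β)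
    (hconn : G.toSimpleGraph.Connected) (hβ : 2 ≤ β) (hcard : 4 * α + 4 ≤ Fintype.card V(G)) :
    ∃ S, IsConnectedSet G.toSimpleGraph S ∧ IsConnectedSet G.toSimpleGraph Sᶜ ∧ α < #S ∧
      α < #Sᶜ := by
  obtain ⟨U, hU, hUc, hUα, hmin⟩ := exists_isConnectedSet_compl_minimal hconn (m := α) (by lia)
  refine ⟨U, hU, hUc, hUα, ?_⟩
  by_contra! hUcα
  obtain ⟨x, hx⟩ := hU.nonempty
  obtain ⟨y, hy⟩ := hUc.nonempty
  obtain ⟨s, -, hs, u, -, hu, hsu⟩ := (isConnectedSet_univ hconn).exists_adj (T := Uᶜ)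
    (mem_univ y) hy (mem_univ x) (by simpa using hx)
  replace hu : u ∈ U := by simpa using hu
  have hcompl := card_add_card_compl U
  have herase : #(univ.erase u) + 1 = Fintype.card V(G) := card_erase_add_one (mem_univ u)
  obtain ⟨D, hD, hDα⟩ := exists_isComponentIn_of_looselyConnected hG le_rfl
    (U := univ.erase u) (.inl (by lia)) (by lia)
  have hDcard := card_sdiff_add_card_eq_card hD.subset
  have huD : u ∉ D := fun h => notMem_erase u _ (hD.subset h)
  have hDU : ¬ D ⊆ U := fun h => by
    have := card_le_of_subset_erase_of_minimal hU hUc hmin hu hs hsu hD.isConnectedSet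
      (subset_erase.2 ⟨h, huD⟩)
    lia
  have hDUc : ¬ D ⊆ Uᶜ := fun h => by
    have := card_le_card h
    lia
  obtain ⟨a, haD, haU⟩ := not_subset.1 hDU
  obtain ⟨b, hbD, hbU⟩ := not_subset.1 hDUc
  obtain ⟨s', -, hs', u', hu'D, hu', hsu'⟩ :=
    hD.isConnectedSet.exists_adj (T := Uᶜ) haD (mem_compl.2 haU) hbD hbU
  replace hu' : u' ∈ U := by simpa using hu'
  have := card_le_two_mul_of_minimal hU hUc hmin hu hs hsu hu' hs' hsu' fun h => huD (h ▸ hu'D)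
  lia

end LooselyConnected

section ThetaSparse

variable {ν ε : Type*} {G : Graph ν ε} [Fintype V(G)] {S T : Finset V(G)} {α β r m : ℕ}

lemma ThetaSparse.edgeCount_le (h : ThetaSparse G r (Fintype.card V(G)))
    (hS : S.Nonempty → IsConnectedSet G.toSimpleGraph S)
    (hT : T.Nonempty → IsConnectedSet G.toSimpleGraph T) (hST : Disjoint S T) :
    edgeCount G S T ≤ r - 1 := by
  classical
  obtain rfl | hSne := S.eq_empty_or_nonempty
  · simp [edgeCount]
  obtain rfl | hTne := T.eq_empty_or_nonempty
  · simp [edgeCount]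
  have hcard := card_le_univ (S ∪ T)
  rw [card_union_of_disjoint hST] at hcard
  exact Nat.le_sub_one_of_lt (h S T (hS hSne) (hT hTne) hST hcard)

lemma ThetaSparse.edgeCount_le_mul_card (h : ThetaSparse G r (Fintype.card V(G)))
    (hT : T.Nonempty → IsConnectedSet G.toSimpleGraph T) (hST : Disjoint S T) :
    edgeCount G S T ≤ (r - 1) * #S := by
  rw [mul_comm, ← smul_eq_mul]
  refine sum_le_card_nsmul _ _ _ fun x hx => ?_
  simpa only [edgeCount, sum_singleton] using h.edgeCount_le
    (fun _ => isConnectedSet_singleton x) hT (disjoint_singleton_left.2 (disjoint_left.1 hST hx))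

lemma ThetaSparse.exists_edgeCount_erase_le [DecidableEq V(G)] [G.Loopless]
    (h : ThetaSparse G r (Fintype.card V(G))) (hS : S.Nonempty) :
    ∃ w ∈ S, edgeCount G {w} (S.erase w) ≤ r - 1 := by
  obtain ⟨x, hx⟩ := hS
  obtain ⟨C, hC, hxC⟩ := exists_isComponentIn (H := G.toSimpleGraph) hx
  obtain ⟨w, hwC, hconn⟩ : ∃ w ∈ C, (C.erase w).Nonempty →
      IsConnectedSet G.toSimpleGraph (C.erase w) := by
    obtain hle | hlt := le_or_gt #C 1
    · refine ⟨x, hxC, fun ⟨y, hy⟩ => ?_⟩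
      exact absurd (card_le_one.1 hle y (mem_of_mem_erase hy) x hxC) (ne_of_mem_erase hy)
    · obtain ⟨w, hw, hconn⟩ := hC.isConnectedSet.exists_erase hlt
      exact ⟨w, hw, fun _ => hconn⟩
  have hfar : edgeCount G {w} (S \ C) = 0 := by
    refine edgeCount_eq_zero_of_forall_not_adj fun a ha b hb hab => ?_
    obtain ⟨hbS, hbC⟩ := mem_sdiff.1 hb
    exact hbC (hC.mem_of_adj a (mem_singleton.1 ha ▸ hwC) b hbS hab)
  have hsplit : S.erase w = C.erase w ∪ S \ C := by
    rw [← sdiff_union_of_subset hC.subset, union_comm, erase_union_distrib]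
    grind
  refine ⟨w, hC.subset hwC, ?_⟩
  rw [hsplit, edgeCount_union_right _ (disjoint_sdiff.mono_left (erase_subset _ _)), hfar, add_zero]
  exact h.edgeCount_le (fun _ => isConnectedSet_singleton w) hconn (by simp)

lemma ThetaSparse.edgeCount_self_le [G.Loopless] (h : ThetaSparse G r (Fintype.card V(G)))
    (S : Finset V(G)) : edgeCount G S S ≤ 2 * ((r - 1) * #S) := by
  classical
  induction S using Finset.strongInduction with
  | H S ih =>
    obtain rfl | hS := S.eq_empty_or_nonempty
    · simp [edgeCount]
    obtain ⟨w, hw, hle⟩ := h.exists_edgeCount_erase_le hS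
    have := ih _ (erase_ssubset hw)
    rw [← insert_erase hw, edgeCount_insert_insert (notMem_erase w S),
      card_insert_of_notMem (notMem_erase w S)]
    lia

lemma ThetaSparse.edgeCount_le_mul_card_add_card [G.Loopless]
    (h : ThetaSparse G r (Fintype.card V(G))) (hST : Disjoint S T) :
    edgeCount G S T ≤ (r - 1) * (#S + #T) := by
  classical
  have hle := h.edgeCount_self_le (S ∪ T)
  rw [edgeCount_union_left hST, edgeCount_union_right _ hST, edgeCount_union_right _ hST,
    edgeCount_comm T S, card_union_of_disjoint hST] at hle
  lia

lemma exists_isConnectedSet_card_sdiff_le_of_looselyConnected [DecidableEq V(G)]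
    (hG : G.LooselyConnected α β) (hcard : Fintype.card V(G) ≤ β + 2 * α) (S : Finset V(G)) :
    ∃ C ⊆ S, (C.Nonempty → IsConnectedSet G.toSimpleGraph C) ∧ #(S \ C) ≤ 6 * α := by
  obtain hle | hlt := le_or_gt #S (3 * (2 * α))
  · exact ⟨∅, empty_subset _, by simp, by simpa using by lia⟩
  · obtain ⟨C, hC, hCα⟩ :=
      exists_isComponentIn_of_looselyConnected hG (a := 2 * α) (by lia) (.inr (by lia)) hlt
    exact ⟨C, hC.subset, fun _ => hC.isConnectedSet, by lia⟩

lemma ThetaSparse.ncard_edgeSet_le_of_looselyConnected [Finite E(G)] [G.Loopless]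
    (h : ThetaSparse G r (Fintype.card V(G))) (hG : G.LooselyConnected α β)
    (hcard : Fintype.card V(G) ≤ β + 2 * α) : E(G).ncard ≤ 2 * ((r - 1) * (1 + 24 * α)) := by
  classical
  obtain ⟨S, T, hST, -, hcut⟩ := exists_edgeCount_self_le_four_mul (univ : Finset V(G))
  rw [edgeCount_univ] at hcut
  obtain ⟨C, hCS, hC, hCα⟩ := exists_isConnectedSet_card_sdiff_le_of_looselyConnected hG hcard S
  obtain ⟨D, hDT, hD, hDα⟩ := exists_isConnectedSet_card_sdiff_le_of_looselyConnected hG hcard T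
  have hsplit : edgeCount G S T = edgeCount G (S \ C) (T \ D) + edgeCount G (S \ C) D +
      (edgeCount G (T \ D) C + edgeCount G C D) := by
    rw [edgeCount_comm (T \ D), ← edgeCount_union_right _ sdiff_disjoint,
      ← edgeCount_union_right _ sdiff_disjoint, ← edgeCount_union_left sdiff_disjoint,
      sdiff_union_of_subset hCS, sdiff_union_of_subset hDT]
  have hCD := h.edgeCount_le hC hD (hST.mono hCS hDT)
  have hSD := h.edgeCount_le_mul_card hD (hST.mono (sdiff_subset (t := C)) hDT)
  have hTC := h.edgeCount_le_mul_card hC (hST.symm.mono (sdiff_subset (t := D)) hCS)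
  have hrest := h.edgeCount_le_mul_card_add_card (hST.mono (sdiff_subset (t := C))
    (sdiff_subset (t := D)))
  have hbound : (r - 1) * (#(S \ C) + #(T \ D) + #(S \ C) + #(T \ D) + 1) ≤
      (r - 1) * (1 + 24 * α) := Nat.mul_le_mul_left _ (by lia)
  lia

lemma ThetaSparse.lt_card_of_looselyConnected [Finite E(G)] [G.Loopless] (h : ThetaSparse G r m)
    (hr : 2 ≤ r) (hα : 1 ≤ α) (hconn : G.toSimpleGraph.Connected)
    (hG : G.LooselyConnected α (2 * r - 1)) (hE : 168 * α * r ≤ E(G).ncard) :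
    m < Fintype.card V(G) := by
  classical
  by_contra! hm
  replace h : ThetaSparse G r (Fintype.card V(G)) :=
    fun S T hS hT hST hcard => h S T hS hT hST (hcard.trans hm)
  obtain hsmall | hlarge := le_or_gt (Fintype.card V(G)) (2 * r - 1 + 2 * α)
  · have := h.ncard_edgeSet_le_of_looselyConnected hG hsmall
    have : (r - 1) * (1 + 24 * α) ≤ r * (25 * α) := Nat.mul_le_mul (by lia) (by lia)
    have : 0 < α * r := by positivity
    lia
  · have hE' := h.edgeCount_self_le univ
    rw [edgeCount_univ, card_univ] at hE'
    have hαcard : 168 * α ≤ Fintype.card V(G) := by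
      refine Nat.le_of_mul_le_mul_left ?_ (zero_lt_two.trans_le hr)
      have : (r - 1) * Fintype.card V(G) ≤ r * Fintype.card V(G) :=
        Nat.mul_le_mul_right _ (Nat.sub_le _ _)
      lia
    obtain ⟨S, hS, hSc, hSα, hScα⟩ :=
      exists_isConnectedSet_compl_of_looselyConnected hG hconn (by lia) (by lia)
    have := h.edgeCount_le (fun _ => hS) (fun _ => hSc) disjoint_compl_right
    have := edgeLooselyConnected_of_looselyConnected hG hlarge S hSα hScα
    lia

end ThetaSparse

section Radius

variable {V : Type*} {H : SimpleGraph V} {S X : Finset V} {h : ℕ}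

/-- Some vertex of `S` is joined to every vertex of `S` by a connected subset of `S` with at most
`h + 1` vertices, so that few vertices suffice to connect few vertices of `S` inside `S`. -/
def HasRadiusLE (H : SimpleGraph V) (h : ℕ) (S : Finset V) : Prop :=
  ∃ t ∈ S, ∀ y ∈ S, ∃ C ⊆ S, IsConnectedSet H C ∧ t ∈ C ∧ y ∈ C ∧ #C ≤ h + 1

lemma HasRadiusLE.exists_superset (hS : HasRadiusLE H h S) (hX : X.Nonempty) (hXS : X ⊆ S) :
    ∃ C, X ⊆ C ∧ C ⊆ S ∧ IsConnectedSet H C ∧ #C ≤ #X * (h + 1) := by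
  classical
  obtain ⟨t, -, ht⟩ := hS
  choose! C hCS hC htC hyC hcard using ht
  refine ⟨X.biUnion C, fun y hy => mem_biUnion.2 ⟨y, hy, hyC y (hXS hy)⟩,
    biUnion_subset.2 fun y hy => hCS y (hXS hy), ?_, ?_⟩
  · exact isConnectedSet_biUnion_of_mem hX (fun y hy => hC y (hXS hy)) fun y hy => htC y (hXS hy)
  · exact card_biUnion_le_card_mul _ _ _ fun y hy => hcard y (hXS hy)

lemma HasRadiusLE.isConnectedSet (hS : HasRadiusLE H h S) : IsConnectedSet H S := by
  obtain ⟨C, hSC, hCS, hC, -⟩ := hS.exists_superset (hS.imp fun _ => And.left) Subset.rfl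
  rwa [hSC.antisymm hCS]

/-- There are fewer than `r` edges between any two disjoint sets of radius at most `h`. -/
def RadiallyThetaSparse {ν ε : Type*} (G : Graph ν ε) (r h : ℕ) : Prop :=
  ∀ S T : Finset V(G), HasRadiusLE G.toSimpleGraph h S → HasRadiusLE G.toSimpleGraph h T →
    Disjoint S T → edgeCount G S T < r

lemma ThetaSparse.radiallyThetaSparse {ν ε : Type*} {G : Graph ν ε} {r m : ℕ}
    (hG : ThetaSparse G r m) (hr : 0 < r) (hm : 2 * (r * (h + 1)) ≤ m) :
    RadiallyThetaSparse G r h := by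
  intro S T hS hT hST
  by_contra! hle
  have nonempty {X Y : Finset V(G)} (hXY : r ≤ edgeCount G X Y) : X.Nonempty :=
    nonempty_of_sum_ne_zero (hr.trans_le hXY).ne'
  obtain ⟨X, hXS, hXr, hX⟩ := exists_subset_card_le_of_le_edgeCount hle
  rw [edgeCount_comm] at hX
  obtain ⟨Y, hYT, hYr, hY⟩ := exists_subset_card_le_of_le_edgeCount hX
  obtain ⟨D, hYD, hDT, hD, hDcard⟩ := hT.exists_superset (nonempty hY) hYT
  rw [edgeCount_comm] at hY
  obtain ⟨C, hXC, hCS, hC, hCcard⟩ := hS.exists_superset (nonempty hY) hXS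
  have hCm := Nat.mul_le_mul_right (h + 1) hXr
  have hDm := Nat.mul_le_mul_right (h + 1) hYr
  exact (hG C D hC hD (hST.mono hCS hDT) (by lia)).not_ge (hY.trans (edgeCount_mono hXC hYD))

end Radius

section RootedForest

variable {V : Type*} {H : SimpleGraph V}

/-- A rooted spanning forest of `H`, encoded by the parents and the depths of the vertices. The
roots are the vertices of depth `0`; they are their own parents. -/
structure RootedForest (H : SimpleGraph V) where
  parent : V → V
  depth : V → ℕ
  parent_of_depth_eq_zero : ∀ x, depth x = 0 → parent x = x
  depth_parent : ∀ x, depth (parent x) = depth x - 1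
  adj_parent : ∀ x, depth x ≠ 0 → H.Adj (parent x) x

namespace RootedForest

variable (F : RootedForest H) {ℓ : ℕ} {v w x y : V}

lemma depth_iterate_parent (i : ℕ) (x : V) : F.depth (F.parent^[i] x) = F.depth x - i := by
  induction i with
  | zero => rfl
  | succ i ih => rw [Function.iterate_succ_apply', F.depth_parent, ih, Nat.sub_sub]

variable [Fintype V]

open Classical in
/-- The vertex set of the subtree rooted at `x`. -/
noncomputable def below (x : V) : Finset V := {y | ∃ i, F.parent^[i] y = x}

variable {F}

lemma mem_below : y ∈ F.below x ↔ ∃ i, F.parent^[i] y = x := by simp [below]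

lemma mem_below_self : x ∈ F.below x := mem_below.2 ⟨0, rfl⟩

lemma below_subset_below (h : y ∈ F.below x) : F.below y ⊆ F.below x := by
  intro z hz
  obtain ⟨i, rfl⟩ := mem_below.1 hz
  obtain ⟨j, rfl⟩ := mem_below.1 h
  exact mem_below.2 ⟨j + i, Function.iterate_add_apply ..⟩

lemma parent_mem_below (hy : y ∈ F.below x) (hne : y ≠ x) : F.parent y ∈ F.below x := by
  obtain ⟨_ | i, rfl⟩ := mem_below.1 hy
  · exact absurd rfl hne
  · exact mem_below.2 ⟨i, rfl⟩

lemma depth_le_of_mem_below (h : y ∈ F.below x) : F.depth x ≤ F.depth y := by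
  obtain ⟨i, rfl⟩ := mem_below.1 h
  exact F.depth_iterate_parent i y ▸ Nat.sub_le _ _

lemma eq_of_mem_below_of_depth_le (h : y ∈ F.below x) (hd : F.depth y ≤ F.depth x) : y = x := by
  obtain ⟨i, rfl⟩ := mem_below.1 h
  rw [F.depth_iterate_parent] at hd
  obtain hy | rfl : F.depth y = 0 ∨ i = 0 := by lia
  · exact (Function.iterate_fixed (F.parent_of_depth_eq_zero y hy) i).symm
  · rfl

lemma parent_eq (hy : y ∈ F.below x) (hd : F.depth y = F.depth x + 1) : F.parent y = x :=
  eq_of_mem_below_of_depth_le (parent_mem_below hy (by rintro rfl; lia))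
    (by rw [F.depth_parent, hd]; rfl)

lemma mem_below_of_mem_below_of_depth_le (hx : w ∈ F.below x) (hy : w ∈ F.below y)
    (hd : F.depth x ≤ F.depth y) : y ∈ F.below x := by
  obtain ⟨i, rfl⟩ := mem_below.1 hx
  obtain ⟨j, rfl⟩ := mem_below.1 hy
  obtain hji | hij := le_total j i
  · exact mem_below.2 ⟨i - j, by rw [← Function.iterate_add_apply, Nat.sub_add_cancel hji]⟩
  · have hmem : F.parent^[i] w ∈ F.below (F.parent^[j] w) :=
      mem_below.2 ⟨j - i, by rw [← Function.iterate_add_apply, Nat.sub_add_cancel hij]⟩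
    rw [eq_of_mem_below_of_depth_le hmem hd]
    exact mem_below_self

lemma disjoint_below (hd : F.depth x = F.depth y) (hne : x ≠ y) :
    Disjoint (F.below x) (F.below y) :=
  disjoint_left.2 fun _ hx hy =>
    hne (eq_of_mem_below_of_depth_le (mem_below_of_mem_below_of_depth_le hy hx hd.ge) hd.le)

lemma exists_mem_below_depth_eq {n : ℕ} (h : n ≤ F.depth x) :
    ∃ t, x ∈ F.below t ∧ F.depth t = n :=
  ⟨F.parent^[F.depth x - n] x, mem_below.2 ⟨_, rfl⟩, by rw [F.depth_iterate_parent]; lia⟩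

lemma depth_sub_depth_le_card_sdiff [DecidableEq V] (h : y ∈ F.below x) :
    F.depth y - F.depth x ≤ #(F.below x \ F.below y) := by
  have hsub : Ico (F.depth x) (F.depth y) ⊆ (F.below x \ F.below y).image F.depth := by
    intro n hn
    obtain ⟨hxn, hny⟩ := mem_Ico.1 hn
    obtain ⟨t, hyt, rfl⟩ := exists_mem_below_depth_eq hny.le
    exact mem_image_of_mem _ (mem_sdiff.2 ⟨mem_below_of_mem_below_of_depth_le h hyt hxn,
      fun hty => hny.not_ge (depth_le_of_mem_below hty)⟩)
  calc F.depth y - F.depth x = #(Ico (F.depth x) (F.depth y)) := (Nat.card_Ico _ _).symm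
    _ ≤ #(F.below x \ F.below y) := (card_le_card hsub).trans card_image_le

lemma depth_lt_depth_add_card_below (h : y ∈ F.below x) :
    F.depth y < F.depth x + #(F.below x) := by
  classical
  have hdepth := depth_sub_depth_le_card_sdiff h
  have hcard := card_sdiff_add_card_eq_card (below_subset_below h)
  have hpos : 0 < #(F.below y) := card_pos.2 ⟨y, mem_below_self⟩
  lia

lemma hasRadiusLE_of_parent_mem {S : Finset V} {h : ℕ} (hx : x ∈ S) (hS : S ⊆ F.below x)
    (hparent : ∀ y ∈ S, y ≠ x → F.parent y ∈ S) (hdepth : ∀ y ∈ S, F.depth y ≤ F.depth x + h) :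
    HasRadiusLE H h S := by
  classical
  suffices hpath : ∀ n, ∀ y ∈ S, F.depth y = F.depth x + n →
      ∃ C ⊆ S, IsConnectedSet H C ∧ x ∈ C ∧ y ∈ C ∧ #C ≤ n + 1 by
    refine ⟨x, hx, fun y hy => ?_⟩
    have hxy := depth_le_of_mem_below (hS hy)
    obtain ⟨C, hCS, hC, hxC, hyC, hcard⟩ :=
      hpath (F.depth y - F.depth x) y hy (Nat.add_sub_of_le hxy).symm
    have hyx := hdepth y hy
    exact ⟨C, hCS, hC, hxC, hyC, by lia⟩
  intro n
  induction n with
  | zero =>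
    intro y hy hd
    obtain rfl := eq_of_mem_below_of_depth_le (hS hy) hd.le
    exact ⟨{y}, by simpa using hy, isConnectedSet_singleton y, by simp, by simp, by simp⟩
  | succ n ih =>
    intro y hy hd
    have hne : y ≠ x := by rintro rfl; lia
    obtain ⟨C, hCS, hC, hxC, hyC, hcard⟩ := ih (F.parent y) (hparent y hy hne)
      (by rw [F.depth_parent, hd]; rfl)
    exact ⟨insert y C, insert_subset hy hCS, hC.insert_of_adj hyC (F.adj_parent y (by lia)),
      mem_insert_of_mem hxC, mem_insert_self y C, (card_insert_le y C).trans (by lia)⟩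

lemma hasRadiusLE_below (hd : ∀ y, F.depth y ≤ ℓ) (x : V) : HasRadiusLE H ℓ (F.below x) :=
  hasRadiusLE_of_parent_mem mem_below_self Subset.rfl (fun _ => parent_mem_below)
    fun y _ => (hd y).trans (Nat.le_add_left ℓ _)

lemma hasRadiusLE_below_sdiff_below [DecidableEq V] (hd : ∀ y, F.depth y ≤ ℓ)
    (hxy : F.depth x < F.depth y) : HasRadiusLE H ℓ (F.below x \ F.below y) := by
  refine hasRadiusLE_of_parent_mem (mem_sdiff.2 ⟨mem_below_self, fun h => ?_⟩) sdiff_subset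
    (fun z hz hne => ?_) fun z _ => (hd z).trans (Nat.le_add_left ℓ _)
  · exact hxy.not_ge (depth_le_of_mem_below h)
  · obtain ⟨hzx, hzy⟩ := mem_sdiff.1 hz
    exact mem_sdiff.2 ⟨parent_mem_below hzx hne, fun h =>
      hzy (below_subset_below h (mem_below.2 ⟨1, rfl⟩))⟩

section Branches

variable [DecidableEq V]

variable (F) in
/-- The vertex sets of the trees into which a tree of `F` is cut by the removal of its vertex `x`,
provided that `F` has only one tree. -/
noncomputable def branches (x : V) : Finset (Finset V) :=
  (insert (F.below x)ᶜ ({c ∈ F.below x | F.depth c = F.depth x + 1}.image F.below)).erase ∅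

lemma mem_branches {B : Finset V} : B ∈ F.branches x ↔ B.Nonempty ∧
    (B = (F.below x)ᶜ ∨ ∃ c ∈ F.below x, F.depth c = F.depth x + 1 ∧ F.below c = B) := by
  simp only [branches, mem_erase, mem_insert, mem_image, mem_filter, nonempty_iff_ne_empty,
    and_assoc]

lemma notMem_of_mem_branches {B : Finset V} (hB : B ∈ F.branches x) : x ∉ B := by
  obtain ⟨-, rfl | ⟨c, -, hc, rfl⟩⟩ := mem_branches.1 hB
  · exact fun h => mem_compl.1 h mem_below_self
  · exact fun h => by have := depth_le_of_mem_below h; lia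

lemma pairwiseDisjoint_branches :
    (F.branches x : Set (Finset V)).PairwiseDisjoint id := by
  intro B hB B' hB' hne
  obtain ⟨-, rfl | ⟨c, hcx, hc, rfl⟩⟩ := mem_branches.1 hB <;>
    obtain ⟨-, rfl | ⟨c', hcx', hc', rfl⟩⟩ := mem_branches.1 hB'
  · exact absurd rfl hne
  · exact disjoint_compl_left.mono_right (below_subset_below hcx')
  · exact disjoint_compl_right.mono_left (below_subset_below hcx)
  · exact disjoint_below (hc.trans hc'.symm) fun h => hne (h ▸ rfl)

lemma erase_subset_biUnion_branches : univ.erase x ⊆ (F.branches x).biUnion id := by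
  intro y hy
  refine mem_biUnion.2 ?_
  by_cases hyx : y ∈ F.below x
  · have hlt : F.depth x < F.depth y := by
      by_contra! hle
      exact ne_of_mem_erase hy (eq_of_mem_below_of_depth_le hyx hle)
    obtain ⟨c, hyc, hc⟩ := exists_mem_below_depth_eq hlt
    have hcx := mem_below_of_mem_below_of_depth_le hyx hyc (by lia)
    exact ⟨F.below c, mem_branches.2 ⟨⟨y, hyc⟩, .inr ⟨c, hcx, hc, rfl⟩⟩, hyc⟩
  · have hyx' := mem_compl.2 hyx
    exact ⟨_, mem_branches.2 ⟨⟨y, hyx'⟩, .inl rfl⟩, hyx'⟩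

lemma depth_lt_of_nonempty_compl_below (hv : F.below v = univ) (hx : (F.below x)ᶜ.Nonempty) :
    F.depth v < F.depth x := by
  have hxv : x ∈ F.below v := hv ▸ mem_univ x
  by_contra! hle
  obtain rfl := eq_of_mem_below_of_depth_le hxv hle
  simp [hv] at hx

lemma isConnectedSet_of_mem_branches (hv : F.below v = univ) {B : Finset V}
    (hB : B ∈ F.branches x) : IsConnectedSet H B := by
  obtain ⟨n, hn⟩ : ∃ n, ∀ y, F.depth y ≤ n :=
    ⟨univ.sup F.depth, fun y => le_sup (mem_univ y)⟩
  obtain ⟨hne, rfl | ⟨c, -, -, rfl⟩⟩ := mem_branches.1 hB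
  · have hconn := hasRadiusLE_below_sdiff_below hn (depth_lt_of_nonempty_compl_below hv hne)
    rw [hv, ← compl_eq_univ_sdiff] at hconn
    exact hconn.isConnectedSet
  · exact (hasRadiusLE_below hn c).isConnectedSet

lemma exists_adj_of_mem_branches (hv : F.below v = univ) {B : Finset V}
    (hB : B ∈ F.branches x) : ∃ y ∈ B, H.Adj x y := by
  obtain ⟨hne, rfl | ⟨c, hcx, hc, rfl⟩⟩ := mem_branches.1 hB
  · have hlt := depth_lt_of_nonempty_compl_below hv hne
    refine ⟨F.parent x, mem_compl.2 fun h => ?_, (F.adj_parent x (by lia)).symm⟩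
    have hle := depth_le_of_mem_below h
    rw [F.depth_parent] at hle
    lia
  · exact ⟨c, mem_below_self, parent_eq hcx hc ▸ F.adj_parent c (by lia)⟩

end Branches

variable (F) in
/-- The forest `F` has height at most `2 * ℓ`, and an edge of `H` at a vertex of depth less than `ℓ`
stays within a tree of `F`. Such a forest arises from a maximal set of roots with pairwise
distances greater than `2 * ℓ` by attaching each vertex to a nearest root. -/
structure IsScattered (ℓ : ℕ) : Prop where
  depth_le : ∀ x, F.depth x ≤ 2 * ℓ
  mem_below_of_adj : ∀ v x y, F.depth v = 0 → x ∈ F.below v → F.depth x < ℓ → H.Adj x y →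
    y ∈ F.below v

lemma IsScattered.below_eq_univ (hF : F.IsScattered ℓ) (hH : H.Connected) (hv : F.depth v = 0)
    (hd : ∀ s ∈ F.below v, F.depth s < ℓ) : F.below v = univ :=
  eq_univ_of_forall fun x => (isConnectedSet_univ hH).forall_of_closed (mem_univ v)
    mem_below_self (fun a _ ha b _ hab => hF.mem_below_of_adj v a b hv ha (hd a ha) hab) x
    (mem_univ x)

lemma depth_add_dist_le (hH : H.Connected) (h : y ∈ F.below x) :
    F.depth x + H.dist x y ≤ F.depth y := by
  obtain ⟨i, rfl⟩ := mem_below.1 h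
  induction i with
  | zero => simp
  | succ i ih =>
    specialize ih (mem_below.2 ⟨i, rfl⟩)
    rw [Function.iterate_succ_apply']
    set x := F.parent^[i] y
    obtain hx | hx := eq_or_ne (F.depth x) 0
    · rwa [F.parent_of_depth_eq_zero x hx]
    · have hdist := hH.dist_triangle (u := F.parent x) (v := x) (w := y)
      rw [SimpleGraph.dist_eq_one_iff_adj.2 (F.adj_parent x hx)] at hdist
      have := F.depth_parent x
      lia

end RootedForest

lemma exists_rootedForest_depth_eq {d : V → ℕ}
    (hd : ∀ x, d x ≠ 0 → ∃ w, H.Adj w x ∧ d w + 1 = d x) : ∃ F : RootedForest H, F.depth = d := by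
  choose! p hadj hdepth using hd
  refine ⟨⟨fun x => if d x = 0 then x else p x, d, fun x hx => if_pos hx, fun x => ?_,
    fun x hx => ?_⟩, rfl⟩
  · split_ifs with hx
    · lia
    · have := hdepth x hx
      lia
  · simpa only [if_neg hx] using hadj x hx

lemma exists_adj_dist_add_one_eq (hH : H.Connected) {x y : V} (hxy : x ≠ y) :
    ∃ w, H.Adj w y ∧ H.dist x w + 1 = H.dist x y := by
  obtain ⟨p, hp⟩ := hH.exists_walk_length_eq_dist y x
  rw [H.dist_comm, ← hp]
  cases p with
  | nil => exact absurd rfl hxy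
  | cons hyw q =>
    rename_i w
    have hq := H.dist_comm.trans_le (SimpleGraph.dist_le q)
    have hwy := SimpleGraph.dist_eq_one_iff_adj.2 hyw.symm
    have htriangle := hH.dist_triangle (u := x) (v := w) (w := y)
    rw [H.dist_comm (u := x) (v := y), ← hp] at htriangle
    simp only [SimpleGraph.Walk.length_cons] at htriangle ⊢
    exact ⟨w, hyw.symm, by lia⟩

lemma exists_separated_covering_set [Finite V] (H : SimpleGraph V) (n : ℕ) :
    ∃ R : Set V, R.Pairwise (n < H.dist · ·) ∧ ∀ x, ∃ v ∈ R, H.dist v x ≤ n := by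
  obtain ⟨R, hR⟩ := (Set.toFinite {R : Set V | R.Pairwise (n < H.dist · ·)}).exists_maximal
    ⟨∅, Set.pairwise_empty _⟩
  refine ⟨R, hR.prop, fun x => ?_⟩
  by_contra! hx
  have hxR : x ∈ R := hR.mem_of_prop_insert
    (hR.prop.insert fun v hv _ => ⟨H.dist_comm ▸ hx v hv, hx v hv⟩)
  exact absurd (hx x hxR) (by simp)

lemma exists_rootedForest_depth_le_dist [Finite V] (hH : H.Connected) {R : Set V}
    (hR : R.Nonempty) : ∃ F : RootedForest H, (∀ x, F.depth x = 0 → x ∈ R) ∧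
      ∀ v ∈ R, ∀ x, F.depth x ≤ H.dist v x := by
  have hnearest : ∀ x, ∃ v ∈ R, ∀ u ∈ R, H.dist v x ≤ H.dist u x := fun x =>
    Set.exists_min_image R (H.dist · x) R.toFinite hR
  choose ρ hρR hρ using hnearest
  have hclose : ∀ x, H.dist (ρ x) x ≠ 0 →
      ∃ w, H.Adj w x ∧ H.dist (ρ w) w + 1 = H.dist (ρ x) x := fun x hx => by
    obtain ⟨w, hwx, hw⟩ := exists_adj_dist_add_one_eq hH (x := ρ x) (y := x)
      (mt hH.dist_eq_zero_iff.2 hx)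
    have hρw := hρ w _ (hρR x)
    have hρx := hρ x _ (hρR w)
    have hdist := hH.dist_triangle (u := ρ w) (v := w) (w := x)
    rw [SimpleGraph.dist_eq_one_iff_adj.2 hwx] at hdist
    exact ⟨w, hwx, by lia⟩
  obtain ⟨F, hF⟩ := exists_rootedForest_depth_eq hclose
  refine ⟨F, fun x hx => ?_, fun v hv x => hF ▸ hρ x v hv⟩
  rw [hF, hH.dist_eq_zero_iff] at hx
  exact hx ▸ hρR x

lemma exists_rootedForest_isScattered [Fintype V] (hH : H.Connected) (ℓ : ℕ) :
    ∃ F : RootedForest H, F.IsScattered ℓ := by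
  obtain ⟨R, hsep, hcover⟩ := exists_separated_covering_set H (2 * ℓ)
  have hR : R.Nonempty := let ⟨v, hv, _⟩ := hcover hH.nonempty.some; ⟨v, hv⟩
  obtain ⟨F, hroot, hdist⟩ := exists_rootedForest_depth_le_dist hH hR
  refine ⟨F, ⟨fun x => ?_, fun v x y hv hx hxℓ hxy => ?_⟩⟩
  · obtain ⟨v, hv, hvx⟩ := hcover x
    exact (hdist v hv x).trans hvx
  · obtain ⟨v', hyv', hv'⟩ := RootedForest.exists_mem_below_depth_eq (Nat.zero_le (F.depth y))
    suffices v = v' from this ▸ hyv'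
    have hadj := SimpleGraph.dist_eq_one_iff_adj.2 hxy
    have hvx := RootedForest.depth_add_dist_le hH hx
    have hvy := hH.dist_triangle (u := v) (v := x) (w := y)
    have hvy' := hdist v (hroot v hv) y
    have hyv := RootedForest.depth_add_dist_le hH hyv'
    have hvv' := hH.dist_triangle (u := v) (v := y) (w := v')
    rw [H.dist_comm (u := y)] at hvv'
    exact hsep.eq (hroot v hv) (hroot v' hv') (by lia)

end RootedForest

section TouchGraph

variable {V : Type*} {H : SimpleGraph V}

/-- Two sets of vertices of `H` are adjacent if they are disjoint and joined by an edge of `H`. A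
minor of `H` given by branch sets is a subgraph of this graph. -/
def touchGraph (H : SimpleGraph V) : SimpleGraph (Finset V) where
  Adj S T := Disjoint S T ∧ ∃ x ∈ S, ∃ y ∈ T, H.Adj x y
  symm := ⟨fun _ _ ⟨hdisj, x, hx, y, hy, hxy⟩ => ⟨hdisj.symm, y, hy, x, hx, hxy.symm⟩⟩
  loopless := ⟨fun _ ⟨hdisj, _, hx, _⟩ => disjoint_left.1 hdisj hx hx⟩

variable {S D : Finset V} {𝓑 : Finset (Finset V)}

lemma IsConnectedSet.filter_touchGraph [DecidableEq V] (hD : IsConnectedSet H D)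
    (h𝓑 : (𝓑 : Set (Finset V)).PairwiseDisjoint id) (hcover : D ⊆ 𝓑.biUnion id) :
    IsConnectedSet (touchGraph H) {B ∈ 𝓑 | ¬Disjoint B D} := by
  have hmem : ∀ x ∈ D, ∃ B ∈ 𝓑, x ∈ B := fun x hx => mem_biUnion.1 (hcover hx)
  choose! f hf𝓑 hf using hmem
  suffices himage : {B ∈ 𝓑 | ¬Disjoint B D} = D.image f by
    rw [himage]
    refine hD.image f fun a ha b hb hab => or_iff_not_imp_left.2 fun hne => ?_
    exact ⟨h𝓑 (hf𝓑 a ha) (hf𝓑 b hb) hne, a, hf a ha, b, hf b hb, hab⟩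
  ext B
  simp only [mem_filter, mem_image, not_disjoint_iff]
  constructor
  · rintro ⟨hB, x, hxB, hxD⟩
    exact ⟨x, hxD, h𝓑.elim_finset (hf𝓑 x hxD) hB x (hf x hxD) hxB⟩
  · rintro ⟨x, hxD, rfl⟩
    exact ⟨hf𝓑 x hxD, x, hf x hxD, hxD⟩

lemma IsConnectedSet.exists_subset_card_eq (hS : IsConnectedSet H S) {k : ℕ} (hk : 0 < k)
    (hkS : k ≤ #S) : ∃ T ⊆ S, IsConnectedSet H T ∧ #T = k := by
  classical
  induction hS using IsConnectedSet.induction with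
  | singleton x =>
    exact ⟨{x}, Subset.rfl, isConnectedSet_singleton x, by rw [card_singleton] at hkS ⊢; lia⟩
  | insert S x y hS hx hy hxy ih =>
    obtain hle | hlt := le_or_gt k #S
    · obtain ⟨T, hTS, hT⟩ := ih hle
      exact ⟨T, hTS.trans (subset_insert y S), hT⟩
    · exact ⟨insert y S, Subset.rfl, hS.insert_of_adj hx hxy,
        by rw [card_insert_of_notMem hy] at hkS ⊢; lia⟩

end TouchGraph

section Hub

variable {ν ε : Type*} {G : Graph ν ε} [Fintype V(G)] [DecidableEq V(G)] [Finite E(G)]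
  {r m α β : ℕ}

lemma ThetaSparse.exists_forall_not_adj (hT : ThetaSparse G r m) (hr : 0 < r)
    (hG : G.LooselyConnected α β) (hβ : 2 ≤ β) (hcard : 1 + α + α * r < Fintype.card V(G))
    (hcard' : 3 * α + 1 < Fintype.card V(G)) (hm : 1 + α * r ≤ m) {x : V(G)}
    {𝓑 : Finset (Finset V(G))} (h𝓑 : (𝓑 : Set (Finset V(G))).PairwiseDisjoint id)
    (hcover : univ.erase x ⊆ 𝓑.biUnion id) (hx : ∀ B ∈ 𝓑, x ∉ B)
    (hconn : ∀ B ∈ 𝓑, IsConnectedSet G.toSimpleGraph B) (hα : ∀ B ∈ 𝓑, #B ≤ α) :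
    ∃ B ∈ 𝓑, ∀ y ∈ B, ¬G.toSimpleGraph.Adj x y := by
  by_contra! hadj
  have herase : #(univ.erase x) + 1 = Fintype.card V(G) := card_erase_add_one (mem_univ x)
  obtain ⟨D, hD, hDcard⟩ := exists_isComponentIn_of_looselyConnected hG le_rfl
    (U := univ.erase x) (.inl (by lia)) (by lia)
  have hDsdiff := card_sdiff_add_card_eq_card hD.subset
  have h𝓓 := hD.isConnectedSet.filter_touchGraph h𝓑 (hD.subset.trans hcover)
  have hr𝓓 : r ≤ #{B ∈ 𝓑 | ¬Disjoint B D} := by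
    have hDcover : D ⊆ {B ∈ 𝓑 | ¬Disjoint B D}.biUnion id := by
      intro y hy
      obtain ⟨B, hB, hyB⟩ := mem_biUnion.1 (hcover (hD.subset hy))
      exact mem_biUnion.2 ⟨B, mem_filter.2 ⟨hB, not_disjoint_iff.2 ⟨y, hyB, hy⟩⟩, hyB⟩
    have hDle := (card_le_card hDcover).trans
      (card_biUnion_le_card_mul _ _ α fun B hB => hα B (mem_filter.1 hB).1)
    by_contra! hlt
    have := Nat.mul_le_mul_left α hlt.le
    lia
  obtain ⟨𝓔, h𝓔𝓓, h𝓔, h𝓔card⟩ := h𝓓.exists_subset_card_eq hr hr𝓓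
  have h𝓔𝓑 : 𝓔 ⊆ 𝓑 := h𝓔𝓓.trans (filter_subset _ _)
  have hW : IsConnectedSet G.toSimpleGraph (𝓔.biUnion id) :=
    h𝓔.biUnion (fun B hB => hconn B (h𝓔𝓑 hB)) fun _ _ _ _ h => h.2
  have hWcard := card_biUnion_le_card_mul 𝓔 id α fun B hB => hα B (h𝓔𝓑 hB)
  have hxW : Disjoint {x} (𝓔.biUnion id) := by
    rw [disjoint_singleton_left, mem_biUnion]
    exact fun ⟨B, hB, hxB⟩ => hx B (h𝓔𝓑 hB) hxB
  refine (hT _ _ (isConnectedSet_singleton x) hW hxW ?_).not_ge ?_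
  · rw [card_singleton]
    lia
  · rw [edgeCount_comm, edgeCount_biUnion_left (h𝓑.subset h𝓔𝓑)]
    calc r = ∑ B ∈ 𝓔, 1 := by rw [sum_const, h𝓔card, smul_eq_mul, mul_one]
      _ ≤ ∑ B ∈ 𝓔, edgeCount G B {x} := sum_le_sum fun B hB => by
          obtain ⟨y, hy, hxy⟩ := hadj B (h𝓔𝓑 hB)
          exact edgeCount_pos_of_adj hy (mem_singleton_self x) hxy.symm

end Hub

namespace RootedForest

section Growth

lemma depth_lt_of_card_below_le {V : Type*} [Fintype V] {H : SimpleGraph V} {F : RootedForest H}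
    {x s : V} {k α : ℕ} (hs : s ∈ F.below x)
    (h : ∀ y ∈ F.below x, F.depth y = F.depth x + k → s ∈ F.below y → #(F.below y) ≤ α) :
    F.depth s < F.depth x + k + α := by
  obtain hlt | hle := lt_or_ge (F.depth s) (F.depth x + k)
  · lia
  · obtain ⟨y, hsy, hy⟩ := exists_mem_below_depth_eq hle
    have hα := h y (mem_below_of_mem_below_of_depth_le hs hsy (by lia)) hy hsy
    have hlt := depth_lt_depth_add_card_below hsy
    lia

variable {ν ε : Type*} {G : Graph ν ε} [Fintype V(G)] [DecidableEq V(G)] {r α ℓ : ℕ}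
  {F : RootedForest G.toSimpleGraph} {v x y : V(G)}

lemma card_lt_card_compl_below (hx : x ∈ F.below v) (hα : F.depth v + α < F.depth x) :
    α < #(F.below x)ᶜ := by
  have hdepth := depth_sub_depth_le_card_sdiff hx
  have hcard := card_le_card
    (sdiff_subset_sdiff (subset_univ (F.below v)) (subset_refl (F.below x)))
  rw [compl_eq_univ_sdiff]
  lia

lemma IsScattered.edgeCount_compl_below_eq_zero [G.Loopless] (hF : F.IsScattered ℓ)
    (hv : F.depth v = 0) {S : Finset V(G)} (hS : S ⊆ F.below v) (hd : ∀ s ∈ S, F.depth s < ℓ) :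
    edgeCount G S (F.below v)ᶜ = 0 :=
  edgeCount_eq_zero_of_forall_not_adj fun s hs _ ht hst =>
    mem_compl.1 ht (hF.mem_below_of_adj v s _ hv (hS hs) (hd s hs) hst)

lemma IsScattered.edgeCount_compl_below_pos (hF : F.IsScattered ℓ)
    (hG : RadiallyThetaSparse G r (2 * ℓ)) (hcut : EdgeLooselyConnected G α (2 * r - 1))
    (hx : x ∈ F.below v) (hα : α < #(F.below x)) (hd : F.depth v + α < F.depth x) :
    0 < edgeCount G (F.below x) (F.below v)ᶜ := by
  have hxv := below_subset_below hx
  have hcompl : (F.below x)ᶜ = F.below v \ F.below x ∪ (F.below v)ᶜ := by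
    rw [compl_eq_univ_sdiff, compl_eq_univ_sdiff, union_comm,
      sdiff_union_sdiff_cancel (subset_univ _) hxv]
  have hout := hcut _ hα (card_lt_card_compl_below hx hd)
  have hin := hG _ _ (hasRadiusLE_below hF.depth_le x)
    (hasRadiusLE_below_sdiff_below hF.depth_le (x := v) (y := x) (by lia)) disjoint_sdiff
  rw [hcompl, edgeCount_union_right _ (disjoint_compl_right.mono_left sdiff_subset)] at hout
  lia

lemma IsScattered.exists_lt_card_below [G.Loopless] (hF : F.IsScattered ℓ)
    (hG : RadiallyThetaSparse G r (2 * ℓ)) (hcut : EdgeLooselyConnected G α (2 * r - 1))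
    (hv : F.depth v = 0) (hx : x ∈ F.below v) (hα : α < #(F.below x)) (hd : α < F.depth x)
    (hdℓ : F.depth x + 2 * α < ℓ) :
    ∃ y ∈ F.below x, F.depth y = F.depth x + (α + 1) ∧ α < #(F.below y) := by
  by_contra! hlight
  refine (hF.edgeCount_compl_below_pos hG hcut hx hα (by lia)).ne'
    (hF.edgeCount_compl_below_eq_zero hv (below_subset_below hx) fun s hs => ?_)
  have := depth_lt_of_card_below_le hs fun y hy hd _ => hlight y hy hd
  lia

lemma IsScattered.exists_ne_lt_card_below [G.Loopless] (hF : F.IsScattered ℓ)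
    (hG : RadiallyThetaSparse G r (2 * ℓ)) (hcut : EdgeLooselyConnected G α (2 * r - 1))
    (hv : F.depth v = 0) (hx : x ∈ F.below v) (hd : α < F.depth x) (hdℓ : F.depth x + 2 * α < ℓ)
    (hy : y ∈ F.below x) (hyd : F.depth y = F.depth x + (α + 1)) (hyα : α < #(F.below y)) :
    ∃ y' ∈ F.below x, y' ≠ y ∧ F.depth y' = F.depth x + (α + 1) ∧ α < #(F.below y') := by
  by_contra! hlight
  have hxv := below_subset_below hx
  have hyx := below_subset_below hy
  have hzero : edgeCount G (F.below x \ F.below y) (F.below v)ᶜ = 0 := by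
    refine hF.edgeCount_compl_below_eq_zero hv (sdiff_subset.trans hxv) fun s hs => ?_
    obtain ⟨hsx, hsy⟩ := mem_sdiff.1 hs
    have := depth_lt_of_card_below_le hsx fun y' hy' hd hsy' =>
      hlight y' hy' (by rintro rfl; exact hsy hsy') hd
    lia
  have hrx := hasRadiusLE_below_sdiff_below hF.depth_le (x := x) (y := y) (by lia)
  have hbelow := hG _ _ hrx (hasRadiusLE_below hF.depth_le y) sdiff_disjoint
  have habove := hG _ _ hrx
    (hasRadiusLE_below_sdiff_below hF.depth_le (x := v) (y := x) (by lia))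
    (disjoint_sdiff.mono_left sdiff_subset)
  have hcompl : (F.below x \ F.below y)ᶜ =
      F.below y ∪ (F.below v \ F.below x) ∪ (F.below v)ᶜ := by
    ext s
    have := @hxv s
    have := @hyx s
    simp only [mem_compl, mem_sdiff, mem_union]
    tauto
  have hS : α < #(F.below x \ F.below y) := by
    have := depth_sub_depth_le_card_sdiff hy
    lia
  have hSc : α < #(F.below x \ F.below y)ᶜ :=
    hyα.trans_le (card_le_card fun s hs => by simp [hs])
  have hout := hcut _ hS hSc
  rw [hcompl, edgeCount_union_right, edgeCount_union_right, hzero] at hout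
  · lia
  · exact disjoint_sdiff.mono_left hyx
  · exact disjoint_compl_right.mono_left (union_subset (hyx.trans hxv) sdiff_subset)

lemma IsScattered.two_pow_le_edgeCount [G.Loopless] (hF : F.IsScattered ℓ)
    (hG : RadiallyThetaSparse G r (2 * ℓ)) (hcut : EdgeLooselyConnected G α (2 * r - 1))
    (hv : F.depth v = 0) (j : ℕ) (hx : x ∈ F.below v) (hα : α < #(F.below x)) (hd : α < F.depth x)
    (hdℓ : F.depth x + j * (α + 1) + α ≤ ℓ) :
    2 ^ j ≤ edgeCount G (F.below x) (F.below v)ᶜ := by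
  induction j generalizing x with
  | zero => exact hF.edgeCount_compl_below_pos hG hcut hx hα (by lia)
  | succ j ih =>
    obtain ⟨y, hy, hyd, hyα⟩ := hF.exists_lt_card_below hG hcut hv hx hα hd (by lia)
    obtain ⟨y', hy', hne, hyd', hyα'⟩ :=
      hF.exists_ne_lt_card_below hG hcut hv hx hd (by lia) hy hyd hyα
    have hyv := ih (below_subset_below hx hy) hyα (by lia) (by lia)
    have hyv' := ih (below_subset_below hx hy') hyα' (by lia) (by lia)
    calc 2 ^ (j + 1) = 2 ^ j + 2 ^ j := by ring
      _ ≤ edgeCount G (F.below y' ∪ F.below y) (F.below v)ᶜ := by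
          rw [edgeCount_union_left (disjoint_below (by lia) hne)]
          exact add_le_add hyv' hyv
      _ ≤ edgeCount G (F.below x) (F.below v)ᶜ := edgeCount_mono
          (union_subset (below_subset_below hy') (below_subset_below hy)) Subset.rfl

lemma IsScattered.card_compl_below_le (hF : F.IsScattered ℓ)
    (hG : RadiallyThetaSparse G r (2 * ℓ)) (hcut : EdgeLooselyConnected G α (2 * r - 1))
    (hv : F.below v = univ) (hx : α < #(F.below x)) : #(F.below x)ᶜ ≤ α := by
  by_contra! hlt
  have hxv := depth_lt_of_nonempty_compl_below hv (card_pos.1 (Nat.zero_lt_of_lt hlt))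
  have hsdiff := hasRadiusLE_below_sdiff_below hF.depth_le hxv
  rw [hv, ← compl_eq_univ_sdiff] at hsdiff
  have hle := hcut _ hx hlt
  have hlt := hG _ _ (hasRadiusLE_below hF.depth_le x) hsdiff disjoint_compl_right
  lia

variable [Finite E(G)] {m : ℕ}

omit [DecidableEq V(G)] in
lemma IsScattered.below_ne_univ (hF : F.IsScattered ℓ) (hT : ThetaSparse G r m)
    (hG : G.LooselyConnected α (2 * r - 1)) (hr : 2 ≤ r) (hℓ : 2 * α < ℓ)
    (hm : 2 * (r * (2 * ℓ + 1)) ≤ m) (hcard : m < Fintype.card V(G)) : F.below v ≠ univ := by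
  classical
  intro hv
  have hrα : 2 * α ≤ r * α := Nat.mul_le_mul_right α hr
  have hrℓ : r * (2 * α + 1) ≤ r * ℓ := Nat.mul_le_mul_left r hℓ
  obtain ⟨x, hx, hmax⟩ := exists_max_image {x | α < #(F.below x)} F.depth
    ⟨v, by simp only [mem_filter, mem_univ, true_and, hv, card_univ]; lia⟩
  replace hx := (mem_filter.1 hx).2
  have hlight : ∀ B ∈ F.branches x, #B ≤ α := by
    intro B hB
    obtain ⟨-, rfl | ⟨c, -, hc, rfl⟩⟩ := mem_branches.1 hB
    · exact hF.card_compl_below_le (hT.radiallyThetaSparse (by lia) hm)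
        (edgeLooselyConnected_of_looselyConnected hG (by lia)) hv hx
    · by_contra! hlt
      have hle := hmax c (mem_filter.2 ⟨mem_univ c, hlt⟩)
      lia
  obtain ⟨B, hB, hnot⟩ := hT.exists_forall_not_adj (by lia) hG (by lia) (by lia) (by lia) (by lia)
    pairwiseDisjoint_branches erase_subset_biUnion_branches (fun B => notMem_of_mem_branches)
    (fun B => isConnectedSet_of_mem_branches hv) hlight
  obtain ⟨y, hy, hxy⟩ := exists_adj_of_mem_branches hv hB
  exact hnot y hy hxy

omit [DecidableEq V(G)] in
lemma IsScattered.exists_depth_eq_lt_card_below (hF : F.IsScattered ℓ)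
    (hT : ThetaSparse G r m) (hconn : G.toSimpleGraph.Connected)
    (hG : G.LooselyConnected α (2 * r - 1)) (hr : 2 ≤ r) (hℓ : 2 * α < ℓ)
    (hm : 2 * (r * (2 * ℓ + 1)) ≤ m) (hcard : m < Fintype.card V(G)) (hv : F.depth v = 0) :
    ∃ x ∈ F.below v, F.depth x = α + 1 ∧ α < #(F.below x) := by
  by_contra! hlight
  refine hF.below_ne_univ hT hG hr hℓ hm hcard (hF.below_eq_univ hconn hv fun s hs => ?_)
  have hlt := depth_lt_of_card_below_le hs (k := α + 1) (α := α) fun y hy hd _ =>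
    hlight y hy (by lia)
  lia

lemma IsScattered.two_pow_le_edgeCount_compl_below [G.Loopless] (hF : F.IsScattered ℓ)
    (hT : ThetaSparse G r m) (hconn : G.toSimpleGraph.Connected)
    (hG : G.LooselyConnected α (2 * r - 1)) (hr : 2 ≤ r) (hm : 2 * (r * (2 * ℓ + 1)) ≤ m)
    (hcard : m < Fintype.card V(G)) (hv : F.depth v = 0) {j : ℕ}
    (hj : (j + 2) * (α + 1) ≤ ℓ) : 2 ^ j ≤ edgeCount G (F.below v) (F.below v)ᶜ := by
  have hℓ : 2 * α < ℓ := by lia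
  have hrα : r * (2 * α + 1) ≤ r * ℓ := Nat.mul_le_mul_left r hℓ
  obtain ⟨x, hxv, hx, hα⟩ := hF.exists_depth_eq_lt_card_below hT hconn hG hr hℓ hm hcard hv
  have hrα' : 2 * α ≤ r * α := Nat.mul_le_mul_right α hr
  have hcut := edgeLooselyConnected_of_looselyConnected hG (by lia)
  exact (hF.two_pow_le_edgeCount (hT.radiallyThetaSparse (by lia) hm) hcut hv j hxv hα (by lia)
    (by lia)).trans (edgeCount_mono (below_subset_below hxv) Subset.rfl)

end Growth

end RootedForest

section Dense

variable {V : Type*} {H : SimpleGraph V} {X Y : Finset V} {k m n s : ℕ}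

lemma exists_subset_isNClique [DecidableRel H.Adj] (hs : 0 < s)
    (hY : ∀ x ∈ Y, #{y ∈ Y | ¬H.Adj x y} ≤ s) (hk : k * s ≤ #Y) :
    ∃ T ⊆ Y, H.IsNClique k T := by
  classical
  induction k generalizing Y with
  | zero => exact ⟨∅, empty_subset Y, SimpleGraph.isNClique_empty.2 rfl⟩
  | succ k ih =>
    rw [Nat.succ_mul] at hk
    obtain ⟨x, hx⟩ : Y.Nonempty := card_pos.1 (by lia)
    have hcard := card_filter_add_card_filter_not (s := Y) (H.Adj x)
    have hxs := hY x hx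
    obtain ⟨T, hTY, hT⟩ := ih (Y := {y ∈ Y | H.Adj x y}) (fun y hy =>
      (card_le_card (filter_subset_filter _ (filter_subset _ Y))).trans
        (hY y (mem_filter.1 hy).1)) (by lia)
    exact ⟨insert x T, insert_subset hx (hTY.trans (filter_subset _ Y)),
      hT.insert fun y hy => (mem_filter.1 (hTY hy)).2⟩

lemma isNClique_image_of_adj {W : Type*} [DecidableEq W] {K : SimpleGraph W} {T : Finset V}
    (hT : H.IsNClique k T) {f : V → W} (hf : ∀ x ∈ T, ∀ y ∈ T, H.Adj x y → K.Adj (f x) (f y)) :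
    K.IsNClique k (T.image f) := by
  have hne : ∀ x ∈ T, ∀ y ∈ T, x ≠ y → K.Adj (f x) (f y) := fun x hx y hy hxy =>
    hf x hx y hy (hT.isClique hx hy hxy)
  refine ⟨?_, ?_⟩
  · rw [coe_image]
    rintro _ ⟨x, hx, rfl⟩ _ ⟨y, hy, rfl⟩ hxy
    exact hne x hx y hy (ne_of_apply_ne f hxy)
  · rw [card_image_of_injOn, hT.card_eq]
    exact fun x hx y hy hxy => by_contra fun h => (hne x hx y hy h).ne hxy

/-- There are `k` disjoint, pairwise adjacent, connected sets of vertices in `X`; these are the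
branch sets of a complete minor. -/
def HasCliqueModel (H : SimpleGraph V) (X : Finset V) (k : ℕ) : Prop :=
  ∃ 𝓒 : Finset (Finset V), (touchGraph H).IsNClique k 𝓒 ∧ ∀ C ∈ 𝓒, C ⊆ X ∧ IsConnectedSet H C

lemma HasCliqueModel.mono (h : HasCliqueModel H X k) (hXY : X ⊆ Y) : HasCliqueModel H Y k := by
  obtain ⟨𝓒, h𝓒, hC⟩ := h
  exact ⟨𝓒, h𝓒, fun C hC' => ⟨(hC C hC').1.trans hXY, (hC C hC').2⟩⟩

lemma hasCliqueModel_of_isNClique (hX : H.IsNClique k X) : HasCliqueModel H X k := by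
  classical
  refine ⟨X.image singleton, isNClique_image_of_adj hX fun x _ y _ hxy => ?_, ?_⟩
  · exact ⟨disjoint_singleton.2 hxy.ne, x, mem_singleton_self x, y, mem_singleton_self y, hxy⟩
  · rintro _ hC
    obtain ⟨x, hx, rfl⟩ := mem_image.1 hC
    exact ⟨singleton_subset_iff.2 hx, isConnectedSet_singleton x⟩

variable [DecidableRel H.Adj]

lemma exists_isConnectedSet_card_le_three [DecidableEq V] {x y : V} (hx : x ∈ Y) (hy : y ∈ Y)
    (h : ¬Disjoint (insert x {w ∈ Y | H.Adj x w}) (insert y {w ∈ Y | H.Adj y w})) :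
    ∃ D ⊆ Y, IsConnectedSet H D ∧ x ∈ D ∧ y ∈ D ∧ #D ≤ 3 := by
  obtain ⟨w, hxw, hyw⟩ := not_disjoint_iff.1 h
  have hwY : w ∈ Y := insert_subset hx (filter_subset _ Y) hxw
  have hwx : IsConnectedSet H {w, x} := by
    obtain rfl | hxw := mem_insert.1 hxw
    · rw [pair_eq_singleton]
      exact isConnectedSet_singleton w
    · exact (isConnectedSet_singleton x).insert_of_adj (mem_singleton_self x) (mem_filter.1 hxw).2
  refine ⟨{y, w, x}, by simp [insert_subset_iff, hx, hy, hwY], ?_, by simp, by simp, card_le_three⟩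
  obtain rfl | hyw := mem_insert.1 hyw
  · rwa [insert_eq_of_mem (mem_insert_self w _)]
  · exact hwx.insert_of_adj (mem_insert_self w _) (mem_filter.1 hyw).2.symm

lemma exists_isConnectedSet_card_le_six (hY : IsConnectedSet H Y)
    (hdeg : ∀ x ∈ Y, n ≤ #{y ∈ Y | H.Adj x y}) (hcard : #Y < 3 * (n + 1)) {x y : V} (hx : x ∈ Y)
    (hy : y ∈ Y) : ∃ D ⊆ Y, IsConnectedSet H D ∧ x ∈ D ∧ y ∈ D ∧ #D ≤ 6 := by
  classical
  let N : V → Finset V := fun a => insert a {b ∈ Y | H.Adj a b}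
  have hNY : ∀ a ∈ Y, N a ⊆ Y := fun a ha => insert_subset ha (filter_subset _ Y)
  have hN : ∀ a ∈ Y, n + 1 ≤ #(N a) := by
    intro a ha
    rw [card_insert_of_notMem fun h => H.irrefl (mem_filter.1 h).2]
    exact Nat.succ_le_succ (hdeg a ha)
  by_cases hxy : Disjoint (N x) (N y)
  swap
  · obtain ⟨D, hDY, hD, hxD, hyD, hDcard⟩ := exists_isConnectedSet_card_le_three hx hy hxy
    exact ⟨D, hDY, hD, hxD, hyD, by lia⟩
  have hcover : ∀ a ∈ Y, Disjoint (N x) (N a) → ¬Disjoint (N y) (N a) := by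
    intro a ha hxa hya
    have hle := card_le_card (union_subset (union_subset (hNY x hx) (hNY y hy)) (hNY a ha))
    rw [card_union_of_disjoint (disjoint_union_left.2 ⟨hxa, hya⟩),
      card_union_of_disjoint hxy] at hle
    have := hN x hx
    have := hN y hy
    have := hN a ha
    lia
  have hxx : ¬Disjoint (N x) (N x) :=
    not_disjoint_iff.2 ⟨x, mem_insert_self x _, mem_insert_self x _⟩
  obtain ⟨a, ha, haT, b, hb, hbT, hab⟩ := hY.exists_adj (T := {a ∈ Y | ¬Disjoint (N x) (N a)}) hx
    (mem_filter.2 ⟨hx, hxx⟩) hy fun h => (mem_filter.1 h).2 hxy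
  have hxb : Disjoint (N x) (N b) := by
    by_contra h
    exact hbT (mem_filter.2 ⟨hb, h⟩)
  obtain ⟨D, hDY, hD, hxD, haD, hDcard⟩ :=
    exists_isConnectedSet_card_le_three hx ha (mem_filter.1 haT).2
  obtain ⟨D', hDY', hD', hyD', hbD', hDcard'⟩ :=
    exists_isConnectedSet_card_le_three hy hb (hcover b hb hxb)
  exact ⟨D ∪ D', union_subset hDY hDY', hD.union_of_adj hD' haD hbD' hab, mem_union_left _ hxD,
    mem_union_right _ hyD', (card_union_le D D').trans (by lia)⟩

lemma exists_isConnectedSet_forall_adj (hY : IsConnectedSet H Y)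
    (hdeg : ∀ x ∈ Y, n ≤ #{y ∈ Y | H.Adj x y}) (hcard : #Y < 3 * (n + 1))
    {𝓒 : Finset (Finset V)} (h𝓒 : ∀ C ∈ 𝓒, ∃ y ∈ Y, ∃ x ∈ C, H.Adj y x) :
    ∃ D ⊆ Y, IsConnectedSet H D ∧ #D ≤ 6 * #𝓒 + 1 ∧ ∀ C ∈ 𝓒, ∃ y ∈ D, ∃ x ∈ C, H.Adj y x := by
  classical
  obtain ⟨x, hx⟩ := hY.nonempty
  obtain rfl | hne := 𝓒.eq_empty_or_nonempty
  · exact ⟨{x}, singleton_subset_iff.2 hx, isConnectedSet_singleton x, by simp, by simp⟩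
  have : Nonempty V := ⟨x⟩
  choose! y hyY hy using h𝓒
  have hpath : ∀ C ∈ 𝓒, ∃ D ⊆ Y, IsConnectedSet H D ∧ x ∈ D ∧ y C ∈ D ∧ #D ≤ 6 := fun C hC =>
    exists_isConnectedSet_card_le_six hY hdeg hcard hx (hyY C hC)
  choose! D hDY hD hxD hyD hDcard using hpath
  refine ⟨𝓒.biUnion D, biUnion_subset.2 hDY, isConnectedSet_biUnion_of_mem hne hD hxD, ?_, ?_⟩
  · have := card_biUnion_le_card_mul 𝓒 D 6 hDcard
    lia
  · exact fun C hC => ⟨y C, mem_biUnion.2 ⟨C, hC, hyD C hC⟩, hy C hC⟩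

lemma card_filter_adj_le_card_filter_adj_sdiff [DecidableEq V] (X Z : Finset V) (x : V) :
    #{y ∈ X | H.Adj x y} ≤ #{y ∈ X \ Z | H.Adj x y} + #Z := by
  refine (card_le_card fun y hy => ?_).trans (card_union_le _ Z)
  simp only [mem_union, mem_filter, mem_sdiff] at hy ⊢
  tauto

lemma hasCliqueModel_of_forall_isConnectedSet_sdiff [DecidableEq V] (hcard : #X ≤ 2 * m + 1)
    (hdeg : ∀ x ∈ X, m ≤ #{y ∈ X | H.Adj x y}) (hs : 3 * s ≤ m) (hs₀ : 0 < s)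
    (hk : 6 * k * k ≤ s) (hconn : ∀ Z ⊆ X, #Z ≤ s → IsConnectedSet H (X \ Z)) :
    HasCliqueModel H X k := by
  suffices h : ∀ i ≤ k, ∃ 𝓒 : Finset (Finset V), (touchGraph H).IsNClique i 𝓒 ∧
      ∀ C ∈ 𝓒, C ⊆ X ∧ IsConnectedSet H C ∧ #C ≤ 6 * k by
    obtain ⟨𝓒, h𝓒, hC⟩ := h k le_rfl
    exact ⟨𝓒, h𝓒, fun C hC' => ⟨(hC C hC').1, (hC C hC').2.1⟩⟩
  intro i
  induction i with
  | zero => exact fun _ => ⟨∅, SimpleGraph.isNClique_empty.2 rfl, by simp⟩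
  | succ i ih =>
    intro hi
    obtain ⟨𝓒, h𝓒, hC⟩ := ih (by lia)
    have hZX : 𝓒.biUnion id ⊆ X := biUnion_subset.2 fun C hC' => (hC C hC').1
    have hZ : #(𝓒.biUnion id) ≤ s :=
      calc #(𝓒.biUnion id) ≤ #𝓒 * (6 * k) :=
            card_biUnion_le_card_mul _ _ _ fun C hC' => (hC C hC').2.2
        _ ≤ k * (6 * k) := Nat.mul_le_mul_right _ (by rw [h𝓒.card_eq]; lia)
        _ ≤ s := by linarith
    set Y := X \ 𝓒.biUnion id
    have hdegY : ∀ x ∈ X, m - s ≤ #{y ∈ Y | H.Adj x y} := by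
      intro x hx
      have := hdeg x hx
      have := card_filter_adj_le_card_filter_adj_sdiff (H := H) X (𝓒.biUnion id) x
      lia
    have hYcard : #Y < 3 * (m - s + 1) := by
      have := card_le_card (sdiff_subset (s := X) (t := 𝓒.biUnion id))
      lia
    obtain ⟨D, hDY, hD, hDcard, hadj⟩ := exists_isConnectedSet_forall_adj (𝓒 := 𝓒)
      (hconn _ hZX hZ) (fun x hx => hdegY x (sdiff_subset hx)) hYcard fun C hC' => by
        obtain ⟨x, hx⟩ := (hC C hC').2.1.nonempty
        have := hdegY x ((hC C hC').1 hx)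
        obtain ⟨y, hy⟩ : {y ∈ Y | H.Adj x y}.Nonempty := card_pos.1 (by lia)
        exact ⟨y, (mem_filter.1 hy).1, x, hx, (mem_filter.1 hy).2.symm⟩
    refine ⟨insert D 𝓒, h𝓒.insert fun C hC' => ⟨?_, hadj C hC'⟩, ?_⟩
    · exact disjoint_sdiff_self_left.mono hDY (subset_biUnion_of_mem id hC')
    · rw [forall_mem_insert]
      exact ⟨⟨hDY.trans sdiff_subset, hD, by rw [h𝓒.card_eq] at hDcard; lia⟩, hC⟩

omit [DecidableRel H.Adj] in
lemma exists_subset_card_le_of_not_isConnectedSet (hY : Y.Nonempty) (hcard : #Y ≤ 2 * m + 1)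
    (hconn : ¬IsConnectedSet H Y) :
    ∃ U ⊆ Y, U.Nonempty ∧ #U ≤ m ∧ ∀ x ∈ U, ∀ y ∈ Y, H.Adj x y → y ∈ U := by
  classical
  obtain ⟨x, hx⟩ := hY
  obtain ⟨C, hC, hxC⟩ := exists_isComponentIn (H := H) hx
  have hsdiff := card_sdiff_add_card_eq_card hC.subset
  obtain hle | hlt := le_or_gt #C m
  · exact ⟨C, hC.subset, ⟨x, hxC⟩, hle, fun a ha b => hC.mem_of_adj a ha b⟩
  refine ⟨Y \ C, sdiff_subset, ?_, by lia, fun a ha b hb hab => ?_⟩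
  · by_contra hempty
    have hCY : C = Y :=
      hC.subset.antisymm (sdiff_eq_empty_iff_subset.1 (not_nonempty_iff_eq_empty.1 hempty))
    exact hconn (hCY ▸ hC.isConnectedSet)
  · obtain ⟨haY, haC⟩ := mem_sdiff.1 ha
    exact mem_sdiff.2 ⟨hb, fun hbC => haC (hC.mem_of_adj b hbC a haY hab.symm)⟩

theorem hasCliqueModel_of_card_le (hX : X.Nonempty) (hcard : #X ≤ 2 * m + 1)
    (hdeg : ∀ x ∈ X, m ≤ #{y ∈ X | H.Adj x y}) (hk : 0 < k) (hm : 18 * k ^ 3 ≤ m) :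
    HasCliqueModel H X k := by
  classical
  have hk2 : 0 < k * k := Nat.mul_pos hk hk
  have hk3 : k * k ≤ k * k * k := Nat.le_mul_of_pos_right _ hk
  have : 18 * (k * k * k) ≤ m := by linarith
  by_cases hconn : ∀ Z ⊆ X, #Z ≤ 6 * k * k → IsConnectedSet H (X \ Z)
  · exact hasCliqueModel_of_forall_isConnectedSet_sdiff hcard hdeg (by lia) (by lia) le_rfl hconn
  push Not at hconn
  obtain ⟨Z, hZX, hZ, hconn⟩ := hconn
  have hsdiff := card_sdiff_add_card_eq_card hZX
  obtain ⟨x, hx⟩ := hX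
  have hmX := (hdeg x hx).trans (card_filter_le X _)
  obtain ⟨Y, hYX, ⟨y, hy⟩, hYcard, hclosed⟩ := exists_subset_card_le_of_not_isConnectedSet
    (m := m) (card_pos.1 (by lia)) (by lia) hconn
  have hdegY : ∀ x ∈ Y, m - 6 * k * k ≤ #{y ∈ Y | H.Adj x y} := by
    intro x hx
    have hle := card_filter_adj_le_card_filter_adj_sdiff (H := H) X Z x
    have hsub : {y ∈ X \ Z | H.Adj x y} ⊆ {y ∈ Y | H.Adj x y} := fun y hy =>
      mem_filter.2 ⟨hclosed x hx y (mem_filter.1 hy).1 (mem_filter.1 hy).2, (mem_filter.1 hy).2⟩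
    have := hdeg x (sdiff_subset (hYX hx))
    have := card_le_card hsub
    lia
  obtain ⟨T, hTY, hT⟩ := exists_subset_isNClique (H := H) (k := k) (s := 6 * k * k) (Y := Y)
    (by lia) (fun x hx => by
      have := card_filter_add_card_filter_not (s := Y) (H.Adj x)
      have := hdegY x hx
      lia) (by
      have := (hdegY y hy).trans (card_filter_le Y _)
      have : k * (6 * k * k) = 6 * (k * k * k) := by ring
      lia)
  exact (hasCliqueModel_of_isNClique hT).mono (hTY.trans (hYX.trans sdiff_subset))

end Dense

section DegreeSum

variable {V : Type*} {H : SimpleGraph V} [DecidableRel H.Adj] {X : Finset V}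
  {x y z : V}

/-- Twice the number of edges of `H` induced on `X`. -/
def degreeSum (H : SimpleGraph V) [DecidableRel H.Adj] (X : Finset V) : ℕ :=
  ∑ x ∈ X, #{y ∈ X | H.Adj x y}

lemma exists_card_mul_le_degreeSum (hX : X.Nonempty) :
    ∃ x ∈ X, #X * #{y ∈ X | H.Adj x y} ≤ degreeSum H X := by
  obtain ⟨x, hx, hmin⟩ := X.exists_min_image (fun x => #{y ∈ X | H.Adj x y}) hX
  exact ⟨x, hx, card_nsmul_le_sum X _ _ hmin⟩

variable [DecidableEq V]

lemma degreeSum_insert (hx : x ∉ X) :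
    degreeSum H (insert x X) = degreeSum H X + 2 * #{y ∈ X | H.Adj x y} := by
  have hterm : ∀ y ∈ X, #{w ∈ insert x X | H.Adj y w} =
      #{w ∈ X | H.Adj y w} + if H.Adj x y then 1 else 0 := by
    intro y _
    by_cases hxy : H.Adj x y
    · rw [filter_insert, if_pos hxy.symm, if_pos hxy,
        card_insert_of_notMem fun h => hx (mem_filter.1 h).1]
    · rw [filter_insert, if_neg fun h => hxy h.symm, if_neg hxy, Nat.add_zero]
  rw [degreeSum, sum_insert hx, filter_insert, if_neg H.irrefl, sum_congr rfl hterm,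
    sum_add_distrib, ← card_filter, degreeSum]
  ring

lemma degreeSum_insert_insert_le (hx : x ∉ insert y X) (hy : y ∉ X) (hz : z ∉ X)
    (hadj : ∀ w ∈ X, H.Adj z w ↔ H.Adj x w ∨ H.Adj y w) :
    degreeSum H (insert x (insert y X)) ≤
      degreeSum H (insert z X) + 2 * #{w ∈ X | H.Adj x w ∧ H.Adj y w} + 2 := by
  have hunion := card_union_add_card_inter {w ∈ X | H.Adj x w} {w ∈ X | H.Adj y w}
  rw [← filter_or, ← filter_and, ← filter_congr hadj] at hunion
  have hinsert : #{w ∈ insert y X | H.Adj x w} ≤ #{w ∈ X | H.Adj x w} + 1 := by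
    rw [filter_insert]
    split_ifs
    · exact card_insert_le _ _
    · exact Nat.le_succ _
  rw [degreeSum_insert hx, degreeSum_insert hy, degreeSum_insert hz]
  lia

end DegreeSum

section BranchFamily

variable {V : Type*} {H : SimpleGraph V} {𝓑 : Finset (Finset V)} {S T : Finset V} {d k : ℕ}

/-- The members of `𝓑` are the branch sets of a minor of `H`, namely of the graph that
`touchGraph H` induces on `𝓑`. -/
structure IsBranchFamily (H : SimpleGraph V) (𝓑 : Finset (Finset V)) : Prop where
  pairwiseDisjoint : (𝓑 : Set (Finset V)).PairwiseDisjoint id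
  isConnectedSet : ∀ B ∈ 𝓑, IsConnectedSet H B

lemma IsBranchFamily.mono (h𝓑 : IsBranchFamily H 𝓑) {𝓒 : Finset (Finset V)} (h : 𝓒 ⊆ 𝓑) :
    IsBranchFamily H 𝓒 :=
  ⟨h𝓑.pairwiseDisjoint.subset h, fun B hB => h𝓑.isConnectedSet B (h hB)⟩

section Contract

variable [DecidableEq V]

lemma IsBranchFamily.disjoint_union (h𝓑 : IsBranchFamily H (insert S (insert T 𝓑)))
    (hS : S ∉ insert T 𝓑) (hT : T ∉ 𝓑) {B : Finset V} (hB : B ∈ 𝓑) : Disjoint (S ∪ T) B := by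
  have hB' : B ∈ insert T 𝓑 := mem_insert_of_mem hB
  have hTS : T ∈ insert S (insert T 𝓑) := mem_insert_of_mem (mem_insert_self T 𝓑)
  rw [disjoint_union_left]
  constructor
  · exact h𝓑.pairwiseDisjoint (mem_insert_self S _) (mem_insert_of_mem hB')
      (ne_of_mem_of_not_mem hB' hS).symm
  · exact h𝓑.pairwiseDisjoint hTS (mem_insert_of_mem hB') (ne_of_mem_of_not_mem hB hT).symm

lemma IsBranchFamily.contract (h𝓑 : IsBranchFamily H (insert S (insert T 𝓑)))
    (hS : S ∉ insert T 𝓑) (hT : T ∉ 𝓑) (hST : (touchGraph H).Adj S T) :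
    IsBranchFamily H (insert (S ∪ T) 𝓑) := by
  have h𝓑' : IsBranchFamily H 𝓑 := h𝓑.mono ((subset_insert T 𝓑).trans (subset_insert S _))
  obtain ⟨-, x, hx, y, hy, hxy⟩ := hST
  refine ⟨?_, forall_mem_insert _ _ _ |>.2 ⟨?_, h𝓑'.isConnectedSet⟩⟩
  · rw [coe_insert]
    exact h𝓑'.pairwiseDisjoint.insert fun B hB _ => h𝓑.disjoint_union hS hT hB
  · exact (h𝓑.isConnectedSet S (mem_insert_self S _)).union_of_adj
      (h𝓑.isConnectedSet T (mem_insert_of_mem (mem_insert_self T 𝓑))) hx hy hxy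

lemma IsBranchFamily.union_notMem (h𝓑 : IsBranchFamily H (insert S (insert T 𝓑)))
    (hS : S ∉ insert T 𝓑) (hT : T ∉ 𝓑) : S ∪ T ∉ 𝓑 := by
  intro h
  obtain ⟨x, hx⟩ := (h𝓑.isConnectedSet S (mem_insert_self S _)).nonempty
  have hx' : x ∈ S ∪ T := mem_union_left T hx
  exact disjoint_left.1 (h𝓑.disjoint_union hS hT h) hx' hx'

open Classical in
lemma IsBranchFamily.degreeSum_le_contract (h𝓑 : IsBranchFamily H (insert S (insert T 𝓑)))
    (hS : S ∉ insert T 𝓑) (hT : T ∉ 𝓑) :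
    degreeSum (touchGraph H) (insert S (insert T 𝓑)) ≤
      degreeSum (touchGraph H) (insert (S ∪ T) 𝓑) +
        2 * #{B ∈ 𝓑 | (touchGraph H).Adj S B ∧ (touchGraph H).Adj T B} + 2 := by
  refine degreeSum_insert_insert_le hS hT (h𝓑.union_notMem hS hT) fun B hB => ?_
  have hdisj := h𝓑.disjoint_union hS hT hB
  obtain ⟨hSB, hTB⟩ := disjoint_union_left.1 hdisj
  constructor
  · rintro ⟨-, x, hx, hxB⟩
    exact (mem_union.1 hx).imp (fun hx => ⟨hSB, x, hx, hxB⟩) fun hx => ⟨hTB, x, hx, hxB⟩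
  · rintro (⟨-, x, hx, hxB⟩ | ⟨-, x, hx, hxB⟩)
    · exact ⟨hdisj, x, mem_union_left T hx, hxB⟩
    · exact ⟨hdisj, x, mem_union_right S hx, hxB⟩

lemma IsBranchFamily.disjoint_biUnion (h𝓑 : IsBranchFamily H 𝓑) {𝓒 𝓓 : Finset (Finset V)}
    (h𝓒 : 𝓒 ⊆ 𝓑) (h𝓓 : 𝓓 ⊆ 𝓑) (hdisj : Disjoint 𝓒 𝓓) :
    Disjoint (𝓒.biUnion id) (𝓓.biUnion id) := by
  rw [disjoint_biUnion_left]
  refine fun C hC => (disjoint_biUnion_right _ _ _).2 fun D hD => ?_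
  exact h𝓑.pairwiseDisjoint (h𝓒 hC) (h𝓓 hD) (ne_of_mem_of_not_mem hC (disjoint_right.1 hdisj hD))

lemma IsBranchFamily.hasCliqueModel_biUnion (h𝓑 : IsBranchFamily H 𝓑)
    (h : HasCliqueModel (touchGraph H) 𝓑 k) : HasCliqueModel H (𝓑.biUnion id) k := by
  obtain ⟨𝓒, h𝓒, hC⟩ := h
  refine ⟨𝓒.image (·.biUnion id), isNClique_image_of_adj h𝓒 ?_, ?_⟩
  · rintro C hC' D hD' ⟨hdisj, B, hB, B', hB', -, x, hx, y, hy, hxy⟩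
    exact ⟨h𝓑.disjoint_biUnion (hC C hC').1 (hC D hD').1 hdisj, x, mem_biUnion.2 ⟨B, hB, hx⟩, y,
      mem_biUnion.2 ⟨B', hB', hy⟩, hxy⟩
  · rintro _ hD
    obtain ⟨C, hC', rfl⟩ := mem_image.1 hD
    obtain ⟨hC𝓑, hCconn⟩ := hC C hC'
    exact ⟨biUnion_subset_biUnion_of_subset_left _ hC𝓑,
      hCconn.biUnion (fun B hB => h𝓑.isConnectedSet B (hC𝓑 hB)) fun _ _ _ _ h => h.2⟩

end Contract

open Classical in
lemma IsBranchFamily.le_card_common_of_minimal (h𝓑 : IsBranchFamily H 𝓑)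
    (hdeg : 2 * d * #𝓑 ≤ degreeSum (touchGraph H) 𝓑)
    (hmin : ∀ 𝓒, IsBranchFamily H 𝓒 → 𝓒.Nonempty → #𝓒 < #𝓑 →
      degreeSum (touchGraph H) 𝓒 < 2 * d * #𝓒)
    (hS : S ∈ 𝓑) (hT : T ∈ 𝓑) (hST : (touchGraph H).Adj S T) :
    d + (degreeSum (touchGraph H) 𝓑 - 2 * d * #𝓑) / 2 ≤
      #{B ∈ 𝓑 | (touchGraph H).Adj S B ∧ (touchGraph H).Adj T B} := by
  obtain ⟨𝓡, hS𝓡, rfl⟩ : ∃ 𝓡, S ∉ 𝓡 ∧ insert S 𝓡 = 𝓑 := ⟨_, notMem_erase S 𝓑, insert_erase hS⟩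
  obtain ⟨𝓡, hT𝓡, rfl⟩ : ∃ 𝓡', T ∉ 𝓡' ∧ insert T 𝓡' = 𝓡 :=
    ⟨_, notMem_erase T 𝓡, insert_erase (mem_of_mem_insert_of_ne hT hST.ne.symm)⟩
  have hcard := card_insert_of_notMem (h𝓑.union_notMem hS𝓡 hT𝓡)
  rw [card_insert_of_notMem hS𝓡, card_insert_of_notMem hT𝓡] at hdeg hmin ⊢
  have hlt := hmin _ (h𝓑.contract hS𝓡 hT𝓡 hST) (insert_nonempty _ _) (by lia)
  have hle := h𝓑.degreeSum_le_contract hS𝓡 hT𝓡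
  have hmono := card_le_card (filter_subset_filter
    (fun B => (touchGraph H).Adj S B ∧ (touchGraph H).Adj T B)
    ((subset_insert T 𝓡).trans (subset_insert S _)))
  rw [hcard] at hlt
  lia

open Classical in
lemma IsBranchFamily.exists_adj_of_minimal (h𝓑 : IsBranchFamily H 𝓑) (hd : 0 < d)
    (hdeg : 2 * d * #𝓑 ≤ degreeSum (touchGraph H) 𝓑)
    (hmin : ∀ 𝓒, IsBranchFamily H 𝓒 → 𝓒.Nonempty → #𝓒 < #𝓑 →
      degreeSum (touchGraph H) 𝓒 < 2 * d * #𝓒) (hS : S ∈ 𝓑) :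
    ∃ T ∈ 𝓑, (touchGraph H).Adj S T := by
  obtain ⟨𝓡, hS𝓡, rfl⟩ : ∃ 𝓡, S ∉ 𝓡 ∧ insert S 𝓡 = 𝓑 := ⟨_, notMem_erase S 𝓑, insert_erase hS⟩
  rw [card_insert_of_notMem hS𝓡] at hdeg hmin
  rw [degreeSum_insert hS𝓡] at hdeg
  have hpos : 0 < #{T ∈ 𝓡 | (touchGraph H).Adj S T} := by
    obtain rfl | hne := 𝓡.eq_empty_or_nonempty
    · rw [degreeSum, sum_empty] at hdeg
      lia
    · have := hmin 𝓡 (h𝓑.mono (subset_insert S 𝓡)) hne (Nat.lt_succ_self _)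
      lia
  obtain ⟨T, hT⟩ := card_pos.1 hpos
  exact ⟨T, mem_insert_of_mem (mem_filter.1 hT).1, (mem_filter.1 hT).2⟩

open Classical in
lemma IsBranchFamily.exists_card_le_forall_le_card_filter_adj (h𝓑 : IsBranchFamily H 𝓑)
    (hne : 𝓑.Nonempty) (hd : 0 < d) (hdeg : 2 * d * #𝓑 ≤ degreeSum (touchGraph H) 𝓑) :
    ∃ 𝓧, IsBranchFamily H 𝓧 ∧ 𝓧.Nonempty ∧ ∃ m, d ≤ m ∧ #𝓧 ≤ 2 * m + 1 ∧
      ∀ B ∈ 𝓧, m ≤ #{C ∈ 𝓧 | (touchGraph H).Adj B C} := by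
  obtain ⟨𝓜, ⟨h𝓜, hne, hdeg⟩, hmin⟩ := exists_minimalFor_of_wellFoundedLT
    (fun 𝓒 => IsBranchFamily H 𝓒 ∧ 𝓒.Nonempty ∧ 2 * d * #𝓒 ≤ degreeSum (touchGraph H) 𝓒) card
    ⟨𝓑, h𝓑, hne, hdeg⟩
  replace hmin : ∀ 𝓒, IsBranchFamily H 𝓒 → 𝓒.Nonempty → #𝓒 < #𝓜 →
      degreeSum (touchGraph H) 𝓒 < 2 * d * #𝓒 := fun 𝓒 h𝓒 hne𝓒 hlt =>
    not_le.1 fun hle => hlt.not_ge (hmin ⟨h𝓒, hne𝓒, hle⟩ hlt.le)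
  obtain ⟨S, hS, hSdeg⟩ := exists_card_mul_le_degreeSum (H := touchGraph H) hne
  obtain ⟨T, hT, hST⟩ := h𝓜.exists_adj_of_minimal hd hdeg hmin hS
  set e := degreeSum (touchGraph H) 𝓜 - 2 * d * #𝓜
  refine ⟨{B ∈ 𝓜 | (touchGraph H).Adj S B}, h𝓜.mono (filter_subset _ 𝓜),
    ⟨T, mem_filter.2 ⟨hT, hST⟩⟩, d + e / 2, Nat.le_add_right d _, ?_, fun B hB => ?_⟩
  · by_contra! hlt
    have hcard := Nat.mul_le_mul_left #𝓜
      (show 2 * d + e + 1 ≤ #{B ∈ 𝓜 | (touchGraph H).Adj S B} by lia)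
    have hpos := card_pos.2 hne
    have := Nat.le_mul_of_pos_left e hpos
    lia
  · rw [filter_filter]
    exact h𝓜.le_card_common_of_minimal hdeg hmin hS (mem_filter.1 hB).1 (mem_filter.1 hB).2

open Classical in
theorem IsBranchFamily.hasCliqueModel [Fintype V] (h𝓑 : IsBranchFamily H 𝓑) (hne : 𝓑.Nonempty)
    (hk : 0 < k) (hdeg : 2 * (18 * k ^ 3) * #𝓑 ≤ degreeSum (touchGraph H) 𝓑) :
    HasCliqueModel H univ k := by
  obtain ⟨𝓧, h𝓧, hne𝓧, m, hm, hcard, hdeg𝓧⟩ :=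
    h𝓑.exists_card_le_forall_le_card_filter_adj hne (by positivity) hdeg
  exact (h𝓧.hasCliqueModel_biUnion
    (hasCliqueModel_of_card_le hne𝓧 hcard hdeg𝓧 hk hm)).mono (subset_univ _)

end BranchFamily

section CliqueMinor

variable {ν ε : Type*} {G : Graph ν ε} {r m k ℓ j α : ℕ}

lemma HasCliqueModel.isMinorOf [Fintype V(G)] (h : HasCliqueModel G.toSimpleGraph univ k)
    (hE : E(G).Finite) : (clique k).IsMinorOf G := by
  classical
  obtain ⟨𝓒, h𝓒, hconn⟩ := h
  let C (i : Fin k) : Finset V(G) := ((equivFinOfCardEq h𝓒.card_eq).symm i).1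
  have hC (i : Fin k) : C i ∈ 𝓒 := ((equivFinOfCardEq h𝓒.card_eq).symm i).2
  have adj {i j : Fin k} (hij : i ≠ j) : (touchGraph G.toSimpleGraph).Adj (C i) (C j) :=
    h𝓒.isClique (hC i) (hC j) fun heq =>
      hij ((equivFinOfCardEq h𝓒.card_eq).symm.injective (Subtype.ext heq))
  refine clique_isMinorOf V(G).toFinite hE (B := fun i => (C i).image Subtype.val)
    (fun i a ha => ?_) (fun i => ?_) (fun i j hij => ?_) (fun i j hij => ?_)
  · obtain ⟨x, -, rfl⟩ := mem_image.1 ha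
    exact x.2
  · exact (hconn _ (hC i)).2.image _ fun x _ y _ hxy =>
      .inr (adjGraph_adj.2 ⟨Subtype.coe_ne_coe.2 hxy.1, hxy.2⟩)
  · exact (disjoint_image Subtype.val_injective).2 (adj hij).1
  · obtain ⟨-, x, hx, y, hy, hxy⟩ := adj hij
    exact ⟨x, mem_image_of_mem _ hx, y, mem_image_of_mem _ hy, hxy.2⟩

lemma edgeCount_biUnion_le [DecidableEq V(G)] [G.Loopless] {S : Finset V(G)}
    [DecidableRel (touchGraph G.toSimpleGraph).Adj]
    {𝓑 : Finset (Finset V(G))} (h𝓑 : (𝓑 : Set (Finset V(G))).PairwiseDisjoint id)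
    (hS : ∀ B ∈ 𝓑, Disjoint S B) (hr : ∀ B ∈ 𝓑, edgeCount G S B ≤ r) :
    edgeCount G S (𝓑.biUnion id) ≤ r * #{B ∈ 𝓑 | (touchGraph G.toSimpleGraph).Adj S B} := by
  rw [edgeCount_comm, edgeCount_biUnion_left h𝓑, mul_comm, ← smul_eq_mul, card_filter,
    sum_smul]
  refine sum_le_sum fun B hB => ?_
  rw [edgeCount_comm, id]
  split_ifs with hSB
  · simpa only [one_smul] using hr B hB
  · rw [edgeCount_eq_zero_of_forall_not_adj fun x hx y hy hxy =>
      hSB ⟨hS B hB, x, hx, y, hy, hxy⟩]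
    exact Nat.zero_le _

namespace RootedForest

variable {V : Type*} [Fintype V] {H : SimpleGraph V}

open Classical in
/-- The vertex sets of the trees of `F`. -/
noncomputable def trees (F : RootedForest H) : Finset (Finset V) :=
  {x | F.depth x = 0}.toFinset.image F.below

lemma mem_trees {F : RootedForest H} {T : Finset V} :
    T ∈ F.trees ↔ ∃ x, F.depth x = 0 ∧ F.below x = T := by
  simp [trees]

lemma biUnion_trees [DecidableEq V] (F : RootedForest H) : F.trees.biUnion id = univ := by
  refine eq_univ_of_forall fun y => ?_
  obtain ⟨x, hyx, hx⟩ := F.exists_mem_below_depth_eq (Nat.zero_le (F.depth y))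
  exact mem_biUnion.2 ⟨_, mem_trees.2 ⟨x, hx, rfl⟩, hyx⟩

lemma isBranchFamily_trees (F : RootedForest H) : IsBranchFamily H F.trees where
  pairwiseDisjoint S hS T hT hST := by
    obtain ⟨x, hx, rfl⟩ := mem_trees.1 hS
    obtain ⟨y, hy, rfl⟩ := mem_trees.1 hT
    exact F.disjoint_below (hx.trans hy.symm) (ne_of_apply_ne F.below hST)
  isConnectedSet T hT := by
    obtain ⟨x, -, rfl⟩ := mem_trees.1 hT
    exact (F.hasRadiusLE_below (fun y => le_sup (mem_univ y)) x).isConnectedSet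

end RootedForest

lemma biUnion_erase_eq_compl {V : Type*} [Fintype V] [DecidableEq V] {𝓑 : Finset (Finset V)}
    (h𝓑 : (𝓑 : Set (Finset V)).PairwiseDisjoint id) (huniv : 𝓑.biUnion id = univ) {B : Finset V}
    (hB : B ∈ 𝓑) : (𝓑.erase B).biUnion id = Bᶜ := by
  ext x
  rw [mem_compl, mem_biUnion]
  constructor
  · rintro ⟨C, hC, hxC⟩ hxB
    exact disjoint_left.1 (h𝓑 (mem_of_mem_erase hC) hB (ne_of_mem_erase hC)) hxC hxB
  · intro hxB
    obtain ⟨C, hC, hxC⟩ := mem_biUnion.1 (huniv ▸ mem_univ x)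
    exact ⟨C, mem_erase.2 ⟨fun h => hxB (h ▸ hxC), hC⟩, hxC⟩

variable [Fintype V(G)] [G.Loopless]

open Classical in
lemma IsBranchFamily.le_card_filter_adj {𝓑 : Finset (Finset V(G))}
    (h𝓑 : IsBranchFamily G.toSimpleGraph 𝓑) (huniv : 𝓑.biUnion id = univ) {d : ℕ} (hr : 0 < r)
    (hradius : ∀ B ∈ 𝓑, HasRadiusLE G.toSimpleGraph m B) (hG : RadiallyThetaSparse G r m)
    {B : Finset V(G)} (hB : B ∈ 𝓑) (hd : d * r ≤ edgeCount G B Bᶜ) :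
    d ≤ #{C ∈ 𝓑 | (touchGraph G.toSimpleGraph).Adj B C} := by
  have hdisj (C) (hC : C ∈ 𝓑.erase B) : Disjoint B C :=
    h𝓑.pairwiseDisjoint hB (mem_of_mem_erase hC) (ne_of_mem_erase hC).symm
  have hcut := edgeCount_biUnion_le (h𝓑.pairwiseDisjoint.subset (erase_subset B 𝓑)) hdisj
    fun C hC => (hG B C (hradius B hB) (hradius C (mem_of_mem_erase hC)) (hdisj C hC)).le
  rw [biUnion_erase_eq_compl h𝓑.pairwiseDisjoint huniv hB, mul_comm r] at hcut
  exact (Nat.le_of_mul_le_mul_right (hd.trans hcut) hr).trans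
    (card_le_card (filter_subset_filter _ (erase_subset B 𝓑)))

theorem ThetaSparse.hasCliqueModel [Finite E(G)] (hT : ThetaSparse G r m)
    (hconn : G.toSimpleGraph.Connected) (hG : G.LooselyConnected α (2 * r - 1)) (hr : 2 ≤ r)
    (hm : 2 * (r * (2 * ℓ + 1)) ≤ m) (hcard : m < Fintype.card V(G)) (hj : (j + 2) * (α + 1) ≤ ℓ)
    (hk : 0 < k) (hkj : 2 * (18 * k ^ 3) * r ≤ 2 ^ j) :
    HasCliqueModel G.toSimpleGraph univ k := by
  classical
  obtain ⟨F, hF⟩ := exists_rootedForest_isScattered hconn ℓ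
  have hne : F.trees.Nonempty := by
    obtain ⟨x⟩ := hconn.nonempty
    obtain ⟨T, hT, -⟩ := mem_biUnion.1 (F.biUnion_trees.ge (mem_univ x))
    exact ⟨T, hT⟩
  refine F.isBranchFamily_trees.hasCliqueModel hne hk ?_
  rw [degreeSum, mul_comm, ← smul_eq_mul]
  refine card_nsmul_le_sum _ _ _ fun B hB => ?_
  refine F.isBranchFamily_trees.le_card_filter_adj F.biUnion_trees (by lia) (fun C hC => ?_)
    (hT.radiallyThetaSparse (by lia) hm) hB ?_
  · obtain ⟨x, -, rfl⟩ := RootedForest.mem_trees.1 hC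
    exact F.hasRadiusLE_below hF.depth_le x
  · obtain ⟨x, hx, rfl⟩ := RootedForest.mem_trees.1 hB
    exact hkj.trans (hF.two_pow_le_edgeCount_compl_below hT hconn hG hr hm hcard hx hj)

end CliqueMinor

section Parameters

lemma exists_mul_pow_three_mul_le_two_pow {q : ℝ} {r : ℕ} (hq : 500 ≤ q)
    (hr : (r : ℝ) ≤ (2 ^ (q / 1000)) ^ 2) :
    ∃ j k : ℕ, 7 ≤ j ∧ 24 * (j + 2) ≤ q ∧ 2 ^ (q / 1000) ≤ (k : ℝ) ∧
      2 * (18 * k ^ 3) * r ≤ 2 ^ j := by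
  set t : ℝ := 2 ^ (q / 1000) with ht
  have ht1 : 1 ≤ t := Real.one_le_rpow one_le_two (by positivity)
  obtain ⟨j, hj⟩ : ∃ j, ⌊q / 24⌋₊ = j + 2 :=
    Nat.exists_eq_add_of_le' (Nat.le_floor (by push_cast; linarith))
  have hjq : (j + 2 : ℝ) ≤ q / 24 := by exact_mod_cast hj ▸ Nat.floor_le (by linarith)
  have hqj : q / 24 < j + 2 + 1 := by exact_mod_cast hj ▸ Nat.lt_floor_add_one (q / 24)
  have hpow : (2 ^ 9 : ℝ) * t ^ 5 ≤ 2 ^ j := by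
    rw [ht, ← Real.rpow_mul_natCast zero_le_two, ← Real.rpow_natCast 2 9, ← Real.rpow_natCast 2 j,
      ← Real.rpow_add two_pos]
    exact Real.rpow_le_rpow_of_exponent_le one_le_two (by push_cast; linarith)
  have hceil : (⌈t⌉₊ : ℝ) ≤ 2 * t := by linarith [Nat.ceil_lt_add_one (zero_le_one.trans ht1)]
  refine ⟨j, ⌈t⌉₊, ?_, by linarith, Nat.le_ceil t, ?_⟩
  · have : (6 : ℝ) < j := by linarith
    exact_mod_cast this
  · have : (2 * (18 * ⌈t⌉₊ ^ 3) * r : ℝ) ≤ 2 ^ j := calc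
      (2 * (18 * ⌈t⌉₊ ^ 3) * r : ℝ) ≤ 2 * (18 * (2 * t) ^ 3) * t ^ 2 := by gcongr
      _ = 288 * t ^ 5 := by ring
      _ ≤ 2 ^ 9 * t ^ 5 := by gcongr; norm_num
      _ ≤ 2 ^ j := hpow
    exact_mod_cast this

lemma five_hundred_lt_of_sqrt_lt {x q : ℝ} (hx : 2 ≤ x) (h : √x < 2 ^ (q / 1000)) : 500 < q := by
  have hpow : (2 : ℝ) ^ (1 : ℝ) < 2 ^ (q / 1000 * (2 : ℕ)) := by
    rw [Real.rpow_mul_natCast zero_le_two, Real.rpow_one]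
    exact hx.trans_lt (Real.lt_sq_of_sqrt_lt h)
  have := (Real.rpow_lt_rpow_left_iff one_lt_two).1 hpow
  push_cast at this
  linarith

lemma exists_parameters {r α : ℕ} {z : ℝ} (hr : 2 ≤ r) (hα : 1 ≤ α) (hz : 1 ≤ z)
    (h : √(r * z) < 2 ^ (1 / 1000 * (z / (r * α)))) :
    ∃ j k : ℕ, 7 ≤ j ∧ r * α * (24 * (j + 2)) ≤ ⌈z⌉₊ ∧
      2 ^ (1 / 1000 * (z / (r * α))) ≤ (k : ℝ) ∧ 2 * (18 * k ^ 3) * r ≤ 2 ^ j := by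
  rw [one_div_mul_eq_div] at h ⊢
  have hr' : (2 : ℝ) ≤ r := by exact_mod_cast hr
  have hrz : (r : ℝ) ≤ r * z := le_mul_of_one_le_right (by positivity) hz
  obtain ⟨j, k, hj, hjz, hk, hkj⟩ := exists_mul_pow_three_mul_le_two_pow
    (five_hundred_lt_of_sqrt_lt (hr'.trans hrz) h).le (hrz.trans (Real.lt_sq_of_sqrt_lt h).le)
  refine ⟨j, k, hj, ?_, hk, hkj⟩
  rw [le_div_iff₀' (by positivity)] at hjz
  exact_mod_cast hjz.trans (Nat.le_ceil z)

lemma one_le_mul_logb {r α : ℕ} (hr : 2 ≤ r) (hα : 1 ≤ α) :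
    1 ≤ 168 * (α : ℝ) * r * Real.logb 2 r := by
  have hr' : (2 : ℝ) ≤ r := by exact_mod_cast hr
  have hα' : (1 : ℝ) ≤ α := by exact_mod_cast hα
  have hlog : 1 ≤ Real.logb 2 r :=
    (Real.le_logb_iff_rpow_le one_lt_two (by positivity)).2 (by rwa [Real.rpow_one])
  have hαr : 1 ≤ (α * r : ℝ) := one_le_mul_of_one_le_of_one_le hα' (by linarith)
  exact one_le_mul_of_one_le_of_one_le (by linarith) hlog

end Parameters

lemma clique_one_isMinorOf {ν ε : Type*} {G : Graph ν ε} (hV : V(G).Finite) (hE : E(G).Finite)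
    {x : ν} (hx : x ∈ V(G)) : (clique 1).IsMinorOf G :=
  clique_isMinorOf hV hE (B := fun _ => {x}) (fun _ _ ha => mem_singleton.1 ha ▸ hx)
    (fun _ => isConnectedSet_singleton x) (fun i j h => absurd (Subsingleton.elim i j) h)
    fun i j h => absurd (Subsingleton.elim i j) h

lemma ThetaSparse.clique_isMinorOf {ν ε : Type*} {G : Graph ν ε} {r α N j k : ℕ}
    [Finite V(G)] [Finite E(G)] [G.Loopless] (hT : ThetaSparse G r (N + 1 - r))
    (hconn : G.toSimpleGraph.Connected) (hG : G.LooselyConnected α (2 * r - 1)) (hr : 2 ≤ r)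
    (hα : 1 ≤ α) (hN : N ≤ E(G).ncard) (hj : 7 ≤ j) (hjN : r * α * (24 * (j + 2)) ≤ N)
    (hk : 0 < k) (hkj : 2 * (18 * k ^ 3) * r ≤ 2 ^ j) : (clique k).IsMinorOf G := by
  have := Fintype.ofFinite V(G)
  have hrα : r ≤ r * α := Nat.le_mul_of_pos_right r hα
  have hrαj : r * α * 9 ≤ r * α * (j + 2) := Nat.mul_le_mul_left _ (by lia)
  have hαj : j + 2 ≤ α * (j + 2) := Nat.le_mul_of_pos_left _ hα
  have hcard := hT.lt_card_of_looselyConnected hr hα hconn hG (by lia)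
  exact (hT.hasCliqueModel (ℓ := 2 * α * (j + 2)) hconn hG hr (by lia) hcard (by lia) hk
    hkj).isMinorOf E(G).toFinite

end LooseConnectivity

open LooseConnectivity in
theorem theorem2_general :
    ∃ c : ℝ, 0 < c ∧
      ∀ (r α : ℕ) (z : ℝ), 2 ≤ r → 1 ≤ α → 1 ≤ z →
      ∀ {ν ε : Type*} (G : Graph ν ε), V(G).Finite → E(G).Finite → G.Loopless →
        G.toSimpleGraph.Connected →
        z ≤ (E(G).ncard : ℝ) →
        G.LooselyConnected α (2 * r - 1) →
        ((⌈z⌉₊ : ℕ) : ℕ∞) ≤ Graph.minorGirth (Graph.theta r) G →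
        ∃ k : ℕ, (2 : ℝ) ^ (c * (z / ((r : ℝ) * (α : ℝ)))) / Real.sqrt ((r : ℝ) * z) ≤ (k : ℝ) ∧
          (Graph.clique k).IsMinorOf G := by
  refine ⟨1 / 1000, by norm_num, ?_⟩
  intro r α z hr hα hz ν ε G hV hE hloop hconn hEz hG hgirth
  have := hV.to_subtype
  have := hE.to_subtype
  have hsqrt : 1 ≤ √(r * z) :=
    Real.one_le_sqrt.2 (one_le_mul_of_one_le_of_one_le (mod_cast one_le_two.trans hr) hz)
  obtain hsmall | hlarge := le_or_gt ((2 : ℝ) ^ (1 / 1000 * (z / (r * α)))) √(r * z)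
  · obtain ⟨x⟩ := hconn.nonempty
    exact ⟨1, by simpa using div_le_one_of_le₀ hsmall (by positivity),
      clique_one_isMinorOf hV hE x.2⟩
  · obtain ⟨j, k, hj, hjz, hk, hkj⟩ := exists_parameters hr hα hz hlarge
    refine ⟨k, (div_le_self (by positivity) hsqrt).trans hk, ?_⟩
    have hk0 : (0 : ℝ) < k := lt_of_lt_of_le (by positivity) hk
    exact (thetaSparse_of_le_minorGirth hgirth).clique_isMinorOf hconn hG hr hα
      (Nat.ceil_le.2 hEz) hj hjz (by exact_mod_cast hk0) hkj

theorem theorem2 :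
    ∃ c : ℝ, 0 < c ∧
      ∀ (r α : ℕ) (z : ℝ), 2 ≤ r → 1 ≤ α → 168 * (α : ℝ) * (r : ℝ) * Real.logb 2 (r : ℝ) ≤ z →
      ∀ {ν ε : Type*} (G : Graph ν ε), V(G).Finite → E(G).Finite → G.Loopless →
        G.toSimpleGraph.Connected →
        z ≤ (E(G).ncard : ℝ) →
        G.LooselyConnected α (2 * r - 1) →
        ((⌈z⌉₊ : ℕ) : ℕ∞) ≤ Graph.minorGirth (Graph.theta r) G →
        ∃ k : ℕ, (2 : ℝ) ^ (c * (z / ((r : ℝ) * (α : ℝ)))) / Real.sqrt ((r : ℝ) * z) ≤ (k : ℝ) ∧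
          (Graph.clique k).IsMinorOf G := by
  obtain ⟨c, hc, h⟩ := theorem2_general
  exact ⟨c, hc, fun r α z hr hα hz => h r α z hr hα
    ((LooseConnectivity.one_le_mul_logb hr hα).trans hz)⟩
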